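/- Let $k$ be a field; all algebras are unital and associative, all coalgebras are counital and coassociative, and $\otimes=\otimes_k$. Conventions. Every algebra $A$ carries its cofinite topology: a subspace is open if and only if it contains a two-sided ideal of finite codimension. For linearly topologized spaces $E,F$, let $E\otimes^! F$ be $E\otimes F$ with the linear topology in which a subspace is open if and only if it contains $E_0\otimes F+E\otimes F_0$ for some open subspaces $E_0\subseteq E$, $F_0\subseteq F$. Write $E^\circ$ for the space of continuous linear functionals $E\to k$ ($k$ discrete). For an algebra $A$, $A^\circ$ is the finite dual, i.e. the functionals whose kernel contains a two-sided ideal of finite codimension; it is a coalgebra with comultiplication dual to multiplication ($\Delta(\varphi)=\sum\varphi_1\otimes\varphi_2$ with $\sum\varphi_1(x)\varphi_2(y)=\varphi(xy)$) and counit $\varphi\mapsto\varphi(1)$. For algebras $A,B$ one has $A^\circ\otimes B^\circ\cong(A\otimes^! B)^\circ$, so a continuous linear map $\rho\colon B\otimes^! A\to A\otimes^! B$ has a continuous dual $\rho^\circ\colon A^\circ\otimes B^\circ\to B^\circ\otimes A^\circ$. For coalgebras $C,D$, a linear map $\phi\colon C\otimes D\to D\otimes C$ is a cotwisting map if $\Delta_\phi=(\mathrm{id}_C\otimes\phi\otimes\mathrm{id}_D)\circ(\Delta_C\otimes\Delta_D)$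 is coassociative on $C\otimes D$ with counit $\varepsilon_C\otimes\varepsilon_D$; the resulting coalgebra is denoted $C\#^\phi D$. Let $H$ be a Hopf algebra over $k$ and let $A$ be a left $H$-module algebra. Let $$\rho\colon H\otimes A\to A\otimes H,\qquad \rho(h\otimes a)=\sum (h_{(1)}\cdot a)\otimes h_{(2)},$$ and let $A\# H$ be the smash product, that is, $A\otimes H$ with identity $1\otimes 1$ and multiplication $(a\otimes g)(b\otimes h)=\sum a(g_{(1)}\cdot b)\otimes g_{(2)}h$. Let $A^H=\{a\in A: h\cdot a=\varepsilon(h)a\text{ for all }h\in H\}$. **Theorem.** Suppose that 1. $A$ is finitely generated both as a left and as a right module over $A^H$; 2. the action of $H$ on $A$ factors through a finite-dimensional Hopf algebra: there are a finite-dimensional Hopf algebra $K$ over $k$, a left $K$-module algebra structure on $A$, and a Hopf algebra homomorphism $\pi\colon H\to K$ with $h\cdot a=\pi(h)\cdot a$ for all $h\in H$, $a\in A$. Then $\rho\colon H\otimes^! A\to A\otimes^! H$ is continuous, $\rho^\circ\colon A^\circ\otimes H^\circ\to H^\circ\otimes A^\circ$ is a cotwisting map, and there is an isomorphism of coalgebras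 $$(A\# H)^\circ\;\cong\;A^\circ\,\#^{\rho^\circ} H^\circ .$$ -/

import Mathlib

open scoped TensorProduct Topology
open Coalgebra

noncomputable section

namespace HopfDual

universe u

/-! ### Linear topologies -/

section LinearTopologies

variable {k : Type*} [Field k]

/-- A linear topology on a vector space, given by its family of open subspaces. -/
structure LinearTopology (k : Type*) [Field k] (E : Type*) [AddCommGroup E] [Module k E] where
  opens : Set (Submodule k E)
  top_mem : ⊤ ∈ opens
  inf_mem : ∀ {V W}, V ∈ opens → W ∈ opens → V ⊓ W ∈ opens
  up_mem : ∀ {V W}, V ∈ opens → V ≤ W → W ∈ opens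

variable {E F G : Type*} [AddCommGroup E] [Module k E] [AddCommGroup F] [Module k F]
  [AddCommGroup G] [Module k G]

namespace LinearTopology

/-- The actual topology: a set is open when it contains, around each of its points `x`, a
translate `x + W` of an open subspace `W`. -/
@[reducible] def toTopology (s : LinearTopology k E) : TopologicalSpace E where
  IsOpen U := ∀ x ∈ U, ∃ W ∈ s.opens, ∀ w ∈ W, x + w ∈ U
  isOpen_univ := fun _ _ => ⟨⊤, s.top_mem, fun _ _ => trivial⟩
  isOpen_inter := fun U V hU hV x hx => by
    obtain ⟨W, hW, h⟩ := hU x hx.1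
    obtain ⟨W', hW', h'⟩ := hV x hx.2
    exact ⟨W ⊓ W', s.inf_mem hW hW', fun w hw => ⟨h w hw.1, h' w hw.2⟩⟩
  isOpen_sUnion := fun S hS x hx => by
    obtain ⟨U, hU, hxU⟩ := hx
    obtain ⟨W, hW, h⟩ := hS U hU x hxU
    exact ⟨W, hW, fun w hw => ⟨U, hU, h w hw⟩⟩

/-- The members of `s.opens` are exactly the open subspaces. -/
theorem isOpen_iff_mem_opens (s : LinearTopology k E) (W : Submodule k E) :
    IsOpen[s.toTopology] (W : Set E) ↔ W ∈ s.opens := by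
  constructor
  · intro h
    obtain ⟨V, hV, h'⟩ := h 0 W.zero_mem
    exact s.up_mem hV fun v hv => by simpa using h' v hv
  · intro h x hx
    exact ⟨W, h, fun w hw => W.add_mem hx hw⟩

/-- Continuity of a linear map between linearly topologized vector spaces. -/
def IsContinuous (s : LinearTopology k E) (t : LinearTopology k F) (f : E →ₗ[k] F) : Prop :=
  Continuous[s.toTopology, t.toTopology] f

theorem isContinuous_iff {s : LinearTopology k E} {t : LinearTopology k F} {f : E →ₗ[k] F} :
    s.IsContinuous t f ↔ ∀ W ∈ t.opens, W.comap f ∈ s.opens := by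
  constructor
  · intro h W hW
    rw [← isOpen_iff_mem_opens]
    exact (@continuous_def _ _ s.toTopology t.toTopology f).1 h W
      ((t.isOpen_iff_mem_opens W).2 hW)
  · intro h
    refine (@continuous_def _ _ s.toTopology t.toTopology f).2 fun U hU x hx => ?_
    obtain ⟨W, hW, h'⟩ := hU (f x) hx
    refine ⟨W.comap f, h W hW, fun w hw => ?_⟩
    simpa using h' (f w) hw

/-- The topology is cofinite: every open subspace has finite codimension. -/
def IsCofinite (s : LinearTopology k E) : Prop :=
  ∀ W ∈ s.opens, W.CoFG

/-- The discrete linear topology. -/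
def discrete (k : Type*) [Field k] (E : Type*) [AddCommGroup E] [Module k E] :
    LinearTopology k E where
  opens := Set.univ
  top_mem := trivial
  inf_mem := fun _ _ => trivial
  up_mem := fun _ _ => trivial

theorem discrete_toTopology : (discrete k E).toTopology = ⊥ := by
  refine eq_bot_of_singletons_open (t := (discrete k E).toTopology) fun x y hy => ?_
  exact ⟨⊥, trivial, fun w hw => by rw [(Submodule.mem_bot k).1 hw, add_zero]; exact hy⟩

/-- The subspace `E₀ ⊗ F + E ⊗ F₀` of `E ⊗ F`. -/
def tensorOpen (E₀ : Submodule k E) (F₀ : Submodule k F) : Submodule k (E ⊗[k] F) :=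
  LinearMap.range (TensorProduct.map E₀.subtype (LinearMap.id : F →ₗ[k] F)) ⊔
    LinearMap.range (TensorProduct.map (LinearMap.id : E →ₗ[k] E) F₀.subtype)

theorem tensorOpen_le_iff {E₀ : Submodule k E} {F₀ : Submodule k F}
    {W : Submodule k (E ⊗[k] F)} :
    tensorOpen E₀ F₀ ≤ W ↔
      (∀ x ∈ E₀, ∀ y, x ⊗ₜ[k] y ∈ W) ∧ (∀ x, ∀ y ∈ F₀, x ⊗ₜ[k] y ∈ W) := by
  constructor
  · intro h
    refine ⟨fun x hx y => h (Submodule.mem_sup_left ?_), fun x y hy =>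
      h (Submodule.mem_sup_right ?_)⟩
    · exact ⟨(⟨x, hx⟩ : E₀) ⊗ₜ y, by simp⟩
    · exact ⟨x ⊗ₜ (⟨y, hy⟩ : F₀), by simp⟩
  · rintro ⟨h1, h2⟩
    refine sup_le ?_ ?_
    · rintro _ ⟨z, rfl⟩
      induction z with
      | zero => simp
      | tmul x y => simpa using h1 x x.2 y
      | add a b ha hb => rw [map_add]; exact W.add_mem ha hb
    · rintro _ ⟨z, rfl⟩
      induction z with
      | zero => simp
      | tmul x y => simpa using h2 x y y.2
      | add a b ha hb => rw [map_add]; exact W.add_mem ha hb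

/-- The topological tensor product `E ⊗^! F`: a subspace is open when it contains
`E₀ ⊗ F + E ⊗ F₀` for some open subspaces `E₀` and `F₀`. -/
def tensor (s : LinearTopology k E) (t : LinearTopology k F) : LinearTopology k (E ⊗[k] F) where
  opens := {W | ∃ E₀ ∈ s.opens, ∃ F₀ ∈ t.opens, tensorOpen E₀ F₀ ≤ W}
  top_mem := ⟨⊤, s.top_mem, ⊤, t.top_mem, le_top⟩
  inf_mem := by
    rintro V W ⟨E₀, hE, F₀, hF, h⟩ ⟨E₁, hE', F₁, hF', h'⟩
    rw [tensorOpen_le_iff] at h h'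
    refine ⟨E₀ ⊓ E₁, s.inf_mem hE hE', F₀ ⊓ F₁, t.inf_mem hF hF', ?_⟩
    rw [tensorOpen_le_iff]
    exact ⟨fun x hx y => ⟨h.1 x hx.1 y, h'.1 x hx.2 y⟩,
      fun x y hy => ⟨h.2 x y hy.1, h'.2 x y hy.2⟩⟩
  up_mem := by
    rintro V W ⟨E₀, hE, F₀, hF, h⟩ hVW
    exact ⟨E₀, hE, F₀, hF, h.trans hVW⟩

theorem isContinuous_discrete_iff {s : LinearTopology k E} {φ : Module.Dual k E} :
    s.IsContinuous (discrete k k) φ ↔ LinearMap.ker φ ∈ s.opens := by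
  rw [isContinuous_iff]
  constructor
  · intro h
    exact h ⊥ trivial
  · intro h W _
    exact s.up_mem h fun x hx => by
      rw [Submodule.mem_comap, LinearMap.mem_ker.1 hx]; exact W.zero_mem

/-- The continuous dual `E°` of a linearly topologized vector space, where the field carries the
discrete topology. -/
def continuousDual (s : LinearTopology k E) : Submodule k (Module.Dual k E) where
  carrier := {φ | s.IsContinuous (discrete k k) φ}
  zero_mem' := isContinuous_discrete_iff.2 (s.up_mem s.top_mem fun _ _ => rfl)
  add_mem' := by
    intro φ ψ hφ hψ
    refine isContinuous_discrete_iff.2 (s.up_mem (s.inf_mem (isContinuous_discrete_iff.1 hφ)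
      (isContinuous_discrete_iff.1 hψ)) fun x hx => ?_)
    rw [LinearMap.mem_ker, LinearMap.add_apply, LinearMap.mem_ker.1 hx.1,
      LinearMap.mem_ker.1 hx.2, add_zero]
  smul_mem' := by
    intro c φ hφ
    refine isContinuous_discrete_iff.2 (s.up_mem (isContinuous_discrete_iff.1 hφ) fun x hx => ?_)
    rw [LinearMap.mem_ker, LinearMap.smul_apply, LinearMap.mem_ker.1 hx, smul_zero]

theorem mem_continuousDual_iff {s : LinearTopology k E} {φ : Module.Dual k E} :
    φ ∈ s.continuousDual ↔ LinearMap.ker φ ∈ s.opens :=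
  isContinuous_discrete_iff

/-- The continuous dual `f° : F° → E°` of a continuous linear map `f : E → F`. -/
def dualMap {s : LinearTopology k E} {t : LinearTopology k F} (f : E →ₗ[k] F)
    (hf : s.IsContinuous t f) : t.continuousDual →ₗ[k] s.continuousDual :=
  (f.dualMap.comp t.continuousDual.subtype).codRestrict s.continuousDual fun φ =>
    mem_continuousDual_iff.2
      (isContinuous_iff.1 hf _ (mem_continuousDual_iff.1 φ.2))

@[simp]
theorem dualMap_apply {s : LinearTopology k E} {t : LinearTopology k F} (f : E →ₗ[k] F)
    (hf : s.IsContinuous t f) (φ : t.continuousDual) (x : E) :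
    (dualMap f hf φ).1 x = φ.1 (f x) := rfl

/-- The natural map `E° ⊗ F° → (E ⊗^! F)°`, `(φ ⊗ ψ)(x ⊗ y) = φ(x) ψ(y)`. -/
def dualTensor (s : LinearTopology k E) (t : LinearTopology k F) :
    s.continuousDual ⊗[k] t.continuousDual →ₗ[k] (s.tensor t).continuousDual :=
  ((TensorProduct.dualDistrib k E F).comp
    (TensorProduct.map s.continuousDual.subtype t.continuousDual.subtype)).codRestrict _ <| by
      intro T
      induction T with
      | zero => rw [map_zero]; exact Submodule.zero_mem _
      | add a b ha hb => rw [map_add]; exact Submodule.add_mem _ ha hb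
      | tmul φ ψ =>
        refine mem_continuousDual_iff.2 ⟨_, mem_continuousDual_iff.1 φ.2, _,
          mem_continuousDual_iff.1 ψ.2, tensorOpen_le_iff.2 ⟨fun x hx y => ?_, fun x y hy => ?_⟩⟩
        · simp [LinearMap.mem_ker.1 hx]
        · simp [LinearMap.mem_ker.1 hy]

@[simp]
theorem dualTensor_tmul_apply (s : LinearTopology k E) (t : LinearTopology k F)
    (φ : s.continuousDual) (ψ : t.continuousDual) (x : E) (y : F) :
    (dualTensor s t (φ ⊗ₜ ψ)).1 (x ⊗ₜ y) = φ.1 x * ψ.1 y := rfl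

end LinearTopology

/-- Two jointly injective families of functionals give a jointly injective family on the tensor
product. -/
theorem eq_of_dualDistrib {U V ι κ : Type*} [AddCommMonoid U] [Module k U] [Module.Free k U]
    [AddCommMonoid V] [Module k V] (p : ι → Module.Dual k U) (q : κ → Module.Dual k V)
    (hp : ∀ x x', (∀ i, p i x = p i x') → x = x') (hq : ∀ y y', (∀ j, q j y = q j y') → y = y')
    (T T' : U ⊗[k] V)
    (hT : ∀ i j, TensorProduct.dualDistrib k U V (p i ⊗ₜ q j) T =
      TensorProduct.dualDistrib k U V (p i ⊗ₜ q j) T') : T = T' := by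
  classical
  let b := Module.Free.chooseBasis k U
  apply (TensorProduct.equivFinsuppOfBasisLeft (N := V) b).injective
  have key : ∀ i j, ∀ S : U ⊗[k] V, p i (TensorProduct.rid k U ((q j).lTensor U S)) =
      TensorProduct.dualDistrib k U V (p i ⊗ₜ q j) S := by
    intro i j S
    induction S with
    | zero => simp
    | add a b ha hb => simp only [map_add, ha, hb]
    | tmul x y => simp [mul_comm]
  have key2 : ∀ j, TensorProduct.rid k U ((q j).lTensor U T) =
      TensorProduct.rid k U ((q j).lTensor U T') := fun j =>
    hp _ _ fun i => by rw [key, key, hT]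
  have key3 : ∀ n j, ∀ S : U ⊗[k] V, q j (TensorProduct.lid k V ((b.coord n).rTensor V S)) =
      b.coord n (TensorProduct.rid k U ((q j).lTensor U S)) := by
    intro n j S
    induction S with
    | zero => simp
    | add a b ha hb => simp only [map_add, ha, hb]
    | tmul x y => simp [mul_comm]
  ext n
  rw [TensorProduct.equivFinsuppOfBasisLeft_apply, TensorProduct.equivFinsuppOfBasisLeft_apply]
  exact hq _ _ fun j => by rw [key3, key3, key2]

namespace LinearTopology

instance (s : LinearTopology k E) : Module.Free k s.continuousDual :=
  Module.Free.of_divisionRing k s.continuousDual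

/-- Evaluation at `x`, as a functional on the continuous dual. -/
def eval (s : LinearTopology k E) (x : E) : Module.Dual k s.continuousDual :=
  (Module.Dual.eval k E x).comp s.continuousDual.subtype

@[simp]
theorem eval_apply (s : LinearTopology k E) (x : E) (φ : s.continuousDual) :
    s.eval x φ = φ.1 x := rfl

theorem eq_of_eval (s : LinearTopology k E) (φ ψ : s.continuousDual)
    (h : ∀ x, s.eval x φ = s.eval x ψ) : φ = ψ :=
  Subtype.ext (LinearMap.ext h)

theorem dualTensor_apply_tmul (s : LinearTopology k E) (t : LinearTopology k F)
    (T : s.continuousDual ⊗[k] t.continuousDual) (x : E) (y : F) :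
    (dualTensor s t T).1 (x ⊗ₜ y) =
      TensorProduct.dualDistrib k _ _ (s.eval x ⊗ₜ t.eval y) T := by
  induction T with
  | zero => simp
  | add a b ha hb => simp only [map_add, Submodule.coe_add, LinearMap.add_apply, ha, hb]
  | tmul φ ψ => simp

theorem dualTensor_injective (s : LinearTopology k E) (t : LinearTopology k F) :
    Function.Injective (dualTensor s t) := by
  intro T T' hT
  refine eq_of_dualDistrib s.eval t.eval s.eq_of_eval t.eq_of_eval T T' fun x y => ?_
  rw [← dualTensor_apply_tmul, ← dualTensor_apply_tmul, hT]

theorem dualTensor_surjective (s : LinearTopology k E) (t : LinearTopology k F)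
    (hs : s.IsCofinite) : Function.Surjective (dualTensor s t) := by
  intro φ
  obtain ⟨E₀, hE, F₀, hF, h⟩ := mem_continuousDual_iff.1 φ.2
  rw [tensorOpen_le_iff] at h
  have : Module.Finite k (E ⧸ E₀) := hs E₀ hE
  let b := Module.finBasis k (E ⧸ E₀)
  choose e he using fun i => E₀.mkQ_surjective (b i)
  let β : Fin (Module.finrank k (E ⧸ E₀)) → s.continuousDual := fun i =>
    ⟨(b.coord i).comp E₀.mkQ, mem_continuousDual_iff.2 (s.up_mem hE fun x hx => by
      rw [LinearMap.mem_ker, LinearMap.comp_apply, Submodule.mkQ_apply,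
        (Submodule.Quotient.mk_eq_zero E₀).2 hx, map_zero])⟩
  let ψ : Fin (Module.finrank k (E ⧸ E₀)) → t.continuousDual := fun i =>
    ⟨φ.1.comp (TensorProduct.mk k E F (e i)), mem_continuousDual_iff.2 (t.up_mem hF fun y hy =>
      h.2 (e i) y hy)⟩
  refine ⟨∑ i, β i ⊗ₜ ψ i, Subtype.ext (TensorProduct.ext' fun x y => ?_)⟩
  have hx : x - ∑ i, (β i).1 x • e i ∈ E₀ := by
    rw [← Submodule.Quotient.mk_eq_zero, ← Submodule.mkQ_apply, map_sub, map_sum]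
    simp only [map_smul, he]
    rw [sub_eq_zero]
    exact (b.sum_repr (E₀.mkQ x)).symm
  have h0 : φ.1 ((x - ∑ i, (β i).1 x • e i) ⊗ₜ[k] y) = 0 := h.1 _ hx y
  rw [TensorProduct.sub_tmul, map_sub, sub_eq_zero, TensorProduct.sum_tmul, map_sum] at h0
  rw [h0, dualTensor_apply_tmul, map_sum]
  refine Finset.sum_congr rfl fun i _ => ?_
  simp only [TensorProduct.dualDistrib_apply, eval_apply, ← TensorProduct.smul_tmul', map_smul,
    smul_eq_mul]
  rfl

/-- The natural isomorphism `E° ⊗ F° ≃ (E ⊗^! F)°` for `E` with a cofinite topology. -/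
def dualTensorEquiv (s : LinearTopology k E) (t : LinearTopology k F) (hs : s.IsCofinite) :
    (s.continuousDual ⊗[k] t.continuousDual) ≃ₗ[k] (s.tensor t).continuousDual :=
  LinearEquiv.ofBijective (dualTensor s t)
    ⟨dualTensor_injective s t, dualTensor_surjective s t hs⟩

theorem dualDistrib_dualTensorEquiv_symm (s : LinearTopology k E) (t : LinearTopology k F)
    (hs : s.IsCofinite) (φ : (s.tensor t).continuousDual) (x : E) (y : F) :
    TensorProduct.dualDistrib k _ _ (s.eval x ⊗ₜ t.eval y) ((dualTensorEquiv s t hs).symm φ) =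
      φ.1 (x ⊗ₜ y) := by
  rw [← dualTensor_apply_tmul]
  have : dualTensor s t ((dualTensorEquiv s t hs).symm φ) = φ :=
    (dualTensorEquiv s t hs).apply_symm_apply φ
  rw [this]

end LinearTopology

end LinearTopologies

/-! ### The cofinite topology of an algebra and its finite dual -/

section FiniteDual

open LinearTopology

variable (k : Type*) [Field k] (A : Type*) [Ring A] [Algebra k A]

/-- The cofinite topology on an algebra: a subspace is open when it contains a two-sided ideal of
finite codimension. -/
def cofinite : LinearTopology k A where
  opens := {W | ∃ I : Ideal A, I.IsTwoSided ∧ (I.restrictScalars k).CoFG ∧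
    I.restrictScalars k ≤ W}
  top_mem := ⟨⊤, inferInstance, by
    rw [Submodule.restrictScalars_top]; exact Submodule.CoFG.top, le_top⟩
  inf_mem := by
    rintro V W ⟨I, hI, hI', h⟩ ⟨J, hJ, hJ', h'⟩
    have e : (I ⊓ J).restrictScalars k = I.restrictScalars k ⊓ J.restrictScalars k := rfl
    refine ⟨I ⊓ J, ⟨fun b ha => ⟨hI.mul_mem_of_left b ha.1, hJ.mul_mem_of_left b ha.2⟩⟩, ?_, ?_⟩
    · rw [e]
      exact Submodule.CoFG.inf hI' hJ'
    · rw [e]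
      exact inf_le_inf h h'
  up_mem := by
    rintro V W ⟨I, hI, hI', h⟩ hVW
    exact ⟨I, hI, hI', h.trans hVW⟩

theorem cofinite_isCofinite : (cofinite k A).IsCofinite := by
  rintro W ⟨I, _, hI, h⟩
  exact hI.of_le h

/-- The open two-sided ideals are exactly those of finite codimension. -/
theorem isOpen_ideal_iff (I : Ideal A) [hI : I.IsTwoSided] :
    IsOpen[(cofinite k A).toTopology] (I : Set A) ↔ (I.restrictScalars k).CoFG := by
  have h := (cofinite k A).isOpen_iff_mem_opens (I.restrictScalars k)
  rw [Submodule.coe_restrictScalars] at h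
  rw [h]
  exact ⟨fun h => cofinite_isCofinite k A _ h, fun h => ⟨I, hI, h, le_rfl⟩⟩

/-- The finite dual `A°`, as the continuous dual for the cofinite topology. -/
abbrev finiteDual : Submodule k (Module.Dual k A) := (cofinite k A).continuousDual

/-- `A°` consists of the functionals whose kernel contains an ideal of finite codimension. -/
theorem mem_finiteDual_iff (φ : Module.Dual k A) :
    φ ∈ finiteDual k A ↔ ∃ I : Ideal A, I.IsTwoSided ∧ (I.restrictScalars k).CoFG ∧
      ∀ x ∈ I, φ x = 0 :=
  mem_continuousDual_iff

theorem isContinuous_mul :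
    ((cofinite k A).tensor (cofinite k A)).IsContinuous (cofinite k A) (LinearMap.mul' k A) := by
  rw [isContinuous_iff]
  rintro W ⟨I, hI, hI', h⟩
  have hmem : I.restrictScalars k ∈ (cofinite k A).opens := ⟨I, hI, hI', le_rfl⟩
  refine ⟨_, hmem, _, hmem, tensorOpen_le_iff.2 ⟨fun x hx y => h ?_, fun x y hy => h ?_⟩⟩
  · exact hI.mul_mem_of_left y hx
  · exact I.mul_mem_left x hy

/-- The comultiplication `m° : A° → (A ⊗^! A)° ≃ A° ⊗ A°` of the finite dual. -/
def finiteDualComul : finiteDual k A →ₗ[k] finiteDual k A ⊗[k] finiteDual k A :=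
  (dualTensorEquiv _ _ (cofinite_isCofinite k A)).symm.toLinearMap.comp
    (dualMap (LinearMap.mul' k A) (isContinuous_mul k A))

/-- `Δ(φ) = ∑ φ₁ ⊗ φ₂` is characterized by `∑ φ₁(x) φ₂(y) = φ(x y)`. -/
theorem dualDistrib_finiteDualComul (φ : finiteDual k A) (x y : A) :
    TensorProduct.dualDistrib k _ _ ((cofinite k A).eval x ⊗ₜ (cofinite k A).eval y)
      (finiteDualComul k A φ) = φ.1 (x * y) :=
  dualDistrib_dualTensorEquiv_symm _ _ (cofinite_isCofinite k A) _ x y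

theorem dualDistrib_assoc {U V W : Type*} [AddCommMonoid U] [Module k U] [AddCommMonoid V]
    [Module k V] [AddCommMonoid W] [Module k W] (p : Module.Dual k U) (q : Module.Dual k V)
    (r : Module.Dual k W) (T : (U ⊗[k] V) ⊗[k] W) :
    TensorProduct.dualDistrib k _ _ (p ⊗ₜ TensorProduct.dualDistrib k _ _ (q ⊗ₜ r))
      (TensorProduct.assoc k U V W T) =
    TensorProduct.dualDistrib k _ _ (TensorProduct.dualDistrib k _ _ (p ⊗ₜ q) ⊗ₜ r) T := by
  have : (TensorProduct.dualDistrib k _ _ (p ⊗ₜ TensorProduct.dualDistrib k _ _ (q ⊗ₜ r))).comp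
      (TensorProduct.assoc k U V W).toLinearMap =
      TensorProduct.dualDistrib k _ _ (TensorProduct.dualDistrib k _ _ (p ⊗ₜ q) ⊗ₜ r) := by
    ext; simp [mul_assoc]
  exact LinearMap.congr_fun this T

theorem dualDistrib_rTensor {U U' V : Type*} [AddCommMonoid U] [Module k U] [AddCommMonoid U']
    [Module k U'] [AddCommMonoid V] [Module k V] (p : Module.Dual k U') (q : Module.Dual k V)
    (f : U →ₗ[k] U') (T : U ⊗[k] V) :
    TensorProduct.dualDistrib k _ _ (p ⊗ₜ q) (f.rTensor V T) =
    TensorProduct.dualDistrib k _ _ ((p.comp f : Module.Dual k U) ⊗ₜ q) T := by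
  have : (TensorProduct.dualDistrib k _ _ (p ⊗ₜ q)).comp (f.rTensor V) =
      TensorProduct.dualDistrib k _ _ ((p.comp f : Module.Dual k U) ⊗ₜ q) := by
    ext; simp
  exact LinearMap.congr_fun this T

theorem dualDistrib_lTensor {U V V' : Type*} [AddCommMonoid U] [Module k U] [AddCommMonoid V']
    [Module k V'] [AddCommMonoid V] [Module k V] (p : Module.Dual k U) (q : Module.Dual k V')
    (f : V →ₗ[k] V') (T : U ⊗[k] V) :
    TensorProduct.dualDistrib k _ _ (p ⊗ₜ q) (f.lTensor U T) =
    TensorProduct.dualDistrib k _ _ (p ⊗ₜ (q.comp f : Module.Dual k V)) T := by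
  have : (TensorProduct.dualDistrib k _ _ (p ⊗ₜ q)).comp (f.lTensor U) =
      TensorProduct.dualDistrib k _ _ (p ⊗ₜ (q.comp f : Module.Dual k V)) := by
    ext; simp
  exact LinearMap.congr_fun this T

theorem dualDistrib_comp_finiteDualComul (x y : A) :
    (TensorProduct.dualDistrib k _ _ ((cofinite k A).eval x ⊗ₜ (cofinite k A).eval y)).comp
      (finiteDualComul k A) = (cofinite k A).eval (x * y) :=
  LinearMap.ext fun φ => dualDistrib_finiteDualComul k A φ x y

/-- The finite dual coalgebra: comultiplication dual to the multiplication, counit dual to the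
unit. -/
instance finiteDualCoalgebra : Coalgebra k (finiteDual k A) where
  comul := finiteDualComul k A
  counit := (cofinite k A).eval 1
  coassoc := by
    ext φ : 1
    refine eq_of_dualDistrib (cofinite k A).eval
      (fun p : A × A => TensorProduct.dualDistrib k _ _
        ((cofinite k A).eval p.1 ⊗ₜ (cofinite k A).eval p.2))
      (cofinite k A).eq_of_eval
      (fun T T' hT => eq_of_dualDistrib (cofinite k A).eval (cofinite k A).eval
        (cofinite k A).eq_of_eval (cofinite k A).eq_of_eval T T' fun x y => hT (x, y)) _ _ ?_
    rintro x ⟨y, z⟩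
    simp only [LinearMap.comp_apply, LinearEquiv.coe_coe]
    rw [dualDistrib_assoc, dualDistrib_rTensor, dualDistrib_lTensor,
      dualDistrib_comp_finiteDualComul, dualDistrib_comp_finiteDualComul,
      dualDistrib_finiteDualComul, dualDistrib_finiteDualComul, mul_assoc]
  rTensor_counit_comp_comul := by
    ext φ : 1
    refine eq_of_dualDistrib (fun _ : Unit => (LinearMap.id : k →ₗ[k] k))
      (cofinite k A).eval (fun _ _ h => h ()) (cofinite k A).eq_of_eval _ _ fun i x => ?_
    rw [LinearMap.comp_apply, dualDistrib_rTensor]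
    change TensorProduct.dualDistrib k _ _ ((cofinite k A).eval 1 ⊗ₜ (cofinite k A).eval x)
      (finiteDualComul k A φ) = _
    rw [dualDistrib_finiteDualComul]
    simp
  lTensor_counit_comp_comul := by
    ext φ : 1
    refine eq_of_dualDistrib (cofinite k A).eval
      (fun _ : Unit => (LinearMap.id : k →ₗ[k] k))
      (cofinite k A).eq_of_eval (fun _ _ h => h ()) _ _ fun x i => ?_
    rw [LinearMap.comp_apply, dualDistrib_lTensor]
    change TensorProduct.dualDistrib k _ _ ((cofinite k A).eval x ⊗ₜ (cofinite k A).eval 1)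
      (finiteDualComul k A φ) = _
    rw [dualDistrib_finiteDualComul]
    simp

end FiniteDual

/-! ### Crossed product algebras and coalgebras -/

section Crossed

variable {k : Type*} [Field k]

/-- The map `id ⊗ f ⊗ id : U ⊗ (V ⊗ W) ⊗ Z → U ⊗ (X ⊗ Y) ⊗ Z`, rebracketed. -/
def middle (U Z : Type*) {V W X Y : Type*} [AddCommMonoid U] [Module k U] [AddCommMonoid Z]
    [Module k Z] [AddCommMonoid V] [Module k V] [AddCommMonoid W] [Module k W] [AddCommMonoid X]
    [Module k X] [AddCommMonoid Y] [Module k Y] (f : V ⊗[k] W →ₗ[k] X ⊗[k] Y) :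
    (U ⊗[k] V) ⊗[k] (W ⊗[k] Z) →ₗ[k] (U ⊗[k] X) ⊗[k] (Y ⊗[k] Z) :=
  (TensorProduct.tensorTensorTensorAssoc k U X Y Z).symm.toLinearMap ∘ₗ
    (f.lTensor U).rTensor Z ∘ₗ (TensorProduct.tensorTensorTensorAssoc k U V W Z).toLinearMap

section Algebras

variable {A B : Type*} [Ring A] [Algebra k A] [Ring B] [Algebra k B]

/-- The multiplication `m_ρ = (m_A ⊗ m_B) ∘ (id_A ⊗ ρ ⊗ id_B)` on `A ⊗ B`. -/
def twistedMul (ρ : B ⊗[k] A →ₗ[k] A ⊗[k] B) :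
    (A ⊗[k] B) ⊗[k] (A ⊗[k] B) →ₗ[k] A ⊗[k] B :=
  TensorProduct.map (LinearMap.mul' k A) (LinearMap.mul' k B) ∘ₗ middle A B ρ

/-- `ρ` is a twisting map: `m_ρ` is associative with identity `1 ⊗ 1`. -/
structure IsTwistingMap (ρ : B ⊗[k] A →ₗ[k] A ⊗[k] B) : Prop where
  assoc : ∀ x y z : A ⊗[k] B,
    twistedMul ρ (twistedMul ρ (x ⊗ₜ y) ⊗ₜ z) = twistedMul ρ (x ⊗ₜ twistedMul ρ (y ⊗ₜ z))
  one_mul : ∀ x : A ⊗[k] B, twistedMul ρ ((1 ⊗ₜ 1) ⊗ₜ x) = x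
  mul_one : ∀ x : A ⊗[k] B, twistedMul ρ (x ⊗ₜ (1 ⊗ₜ 1)) = x

/-- The twisted tensor product algebra `A #_ρ B`: the space `A ⊗ B` with multiplication `m_ρ`. -/
def TwistedTensor (ρ : B ⊗[k] A →ₗ[k] A ⊗[k] B) (_hρ : IsTwistingMap ρ) : Type _ := A ⊗[k] B

theorem twistedMul_tmul (ρ : B ⊗[k] A →ₗ[k] A ⊗[k] B) (a c : A) (b d : B) :
    twistedMul ρ ((a ⊗ₜ b) ⊗ₜ (c ⊗ₜ d)) =
      TensorProduct.map (LinearMap.mulLeft k a) (LinearMap.mulRight k d) (ρ (b ⊗ₜ c)) := by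
  have : ∀ S : A ⊗[k] B, TensorProduct.map (LinearMap.mul' k A) (LinearMap.mul' k B)
      ((TensorProduct.tensorTensorTensorAssoc k A A B B).symm ((a ⊗ₜ S) ⊗ₜ d)) =
      TensorProduct.map (LinearMap.mulLeft k a) (LinearMap.mulRight k d) S := by
    intro S
    induction S with
    | zero => simp
    | add x y hx hy => simp only [TensorProduct.add_tmul, TensorProduct.tmul_add, map_add, hx, hy]
    | tmul x y => simp
  exact this _

variable {ρ : B ⊗[k] A →ₗ[k] A ⊗[k] B} (hρ : IsTwistingMap ρ)

instance : AddCommGroup (TwistedTensor ρ hρ) := inferInstanceAs (AddCommGroup (A ⊗[k] B))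

instance : Module k (TwistedTensor ρ hρ) := inferInstanceAs (Module k (A ⊗[k] B))

instance : Ring (TwistedTensor ρ hρ) :=
  { (inferInstance : AddCommGroup (TwistedTensor ρ hρ)) with
    mul := fun x y => twistedMul ρ ((show A ⊗[k] B from x) ⊗ₜ (show A ⊗[k] B from y))
    one := ((1 : A) ⊗ₜ[k] (1 : B) : A ⊗[k] B)
    mul_assoc := hρ.assoc
    one_mul := hρ.one_mul
    mul_one := hρ.mul_one
    left_distrib := fun x y z => by
      change twistedMul ρ ((show A ⊗[k] B from x) ⊗ₜ
        ((show A ⊗[k] B from y) + (show A ⊗[k] B from z))) = _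
      rw [TensorProduct.tmul_add, map_add]; rfl
    right_distrib := fun x y z => by
      change twistedMul ρ (((show A ⊗[k] B from x) + (show A ⊗[k] B from y)) ⊗ₜ
        (show A ⊗[k] B from z)) = _
      rw [TensorProduct.add_tmul, map_add]; rfl
    zero_mul := fun x => by
      change twistedMul ρ ((0 : A ⊗[k] B) ⊗ₜ (show A ⊗[k] B from x)) = _
      rw [TensorProduct.zero_tmul, map_zero]; rfl
    mul_zero := fun x => by
      change twistedMul ρ ((show A ⊗[k] B from x) ⊗ₜ (0 : A ⊗[k] B)) = _
      rw [TensorProduct.tmul_zero, map_zero]; rfl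
    zsmul := fun n x => n • x
    nsmul := fun n x => n • x }

theorem TwistedTensor.mul_def (x y : TwistedTensor ρ hρ) :
    x * y = twistedMul ρ ((show A ⊗[k] B from x) ⊗ₜ (show A ⊗[k] B from y)) := rfl

instance : Algebra k (TwistedTensor ρ hρ) :=
  Algebra.ofModule
    (fun r x y => by
      change twistedMul ρ ((r • (show A ⊗[k] B from x)) ⊗ₜ (show A ⊗[k] B from y)) =
        r • twistedMul ρ _
      rw [← TensorProduct.smul_tmul', map_smul])
    (fun r x y => by
      change twistedMul ρ ((show A ⊗[k] B from x) ⊗ₜ (r • (show A ⊗[k] B from y))) =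
        r • twistedMul ρ _
      rw [TensorProduct.tmul_smul, map_smul])

end Algebras

section Coalgebras

variable {C D : Type*} [AddCommMonoid C] [Module k C] [Coalgebra k C] [AddCommMonoid D] [Module k D]
  [Coalgebra k D]

/-- The comultiplication `Δ_φ = (id_C ⊗ φ ⊗ id_D) ∘ (Δ_C ⊗ Δ_D)` on `C ⊗ D`. -/
def crossedComul (φ : C ⊗[k] D →ₗ[k] D ⊗[k] C) :
    C ⊗[k] D →ₗ[k] (C ⊗[k] D) ⊗[k] (C ⊗[k] D) :=
  middle C D φ ∘ₗ TensorProduct.map comul comul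

/-- The counit `ε_C ⊗ ε_D` on `C ⊗ D`. -/
def crossedCounit (k C D : Type*) [Field k] [AddCommMonoid C] [Module k C] [Coalgebra k C]
    [AddCommMonoid D] [Module k D] [Coalgebra k D] : C ⊗[k] D →ₗ[k] k :=
  TensorProduct.dualDistrib k C D ((counit : C →ₗ[k] k) ⊗ₜ (counit : D →ₗ[k] k))

/-- `φ` is a cotwisting map: `Δ_φ` is coassociative with counit `ε_C ⊗ ε_D`. -/
structure IsCotwistingMap (φ : C ⊗[k] D →ₗ[k] D ⊗[k] C) : Prop where
  coassoc : (TensorProduct.assoc k (C ⊗[k] D) (C ⊗[k] D) (C ⊗[k] D)).toLinearMap ∘ₗ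
    (crossedComul φ).rTensor (C ⊗[k] D) ∘ₗ crossedComul φ =
      (crossedComul φ).lTensor (C ⊗[k] D) ∘ₗ crossedComul φ
  rTensor_counit : (crossedCounit k C D).rTensor (C ⊗[k] D) ∘ₗ crossedComul φ =
    TensorProduct.mk k k (C ⊗[k] D) 1
  lTensor_counit : (crossedCounit k C D).lTensor (C ⊗[k] D) ∘ₗ crossedComul φ =
    (TensorProduct.mk k (C ⊗[k] D) k).flip 1

/-- The crossed product coalgebra `C #^φ D`: the space `C ⊗ D` with comultiplication `Δ_φ` and
counit `ε_C ⊗ ε_D`. -/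
def CrossedCoalgebra (φ : C ⊗[k] D →ₗ[k] D ⊗[k] C) (_hφ : IsCotwistingMap φ) : Type _ :=
  C ⊗[k] D

variable {φ : C ⊗[k] D →ₗ[k] D ⊗[k] C} (hφ : IsCotwistingMap φ)

instance : AddCommMonoid (CrossedCoalgebra φ hφ) := inferInstanceAs (AddCommMonoid (C ⊗[k] D))

instance : Module k (CrossedCoalgebra φ hφ) := inferInstanceAs (Module k (C ⊗[k] D))

instance : Coalgebra k (CrossedCoalgebra φ hφ) where
  comul := crossedComul φ
  counit := crossedCounit k C D
  coassoc := hφ.coassoc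
  rTensor_counit_comp_comul := hφ.rTensor_counit
  lTensor_counit_comp_comul := hφ.lTensor_counit

end Coalgebras

section Dual

open LinearTopology

variable {A B : Type*} [Ring A] [Algebra k A] [Ring B] [Algebra k B]

/-- Continuity of `ρ : B ⊗^! A → A ⊗^! B` for the cofinite topologies on `A` and `B`. -/
def IsContinuousTwist (ρ : B ⊗[k] A →ₗ[k] A ⊗[k] B) : Prop :=
  ((cofinite k B).tensor (cofinite k A)).IsContinuous ((cofinite k A).tensor (cofinite k B)) ρ

/-- The continuous dual `ρ° : A° ⊗ B° ≃ (A ⊗^! B)° → (B ⊗^! A)° ≃ B° ⊗ A°`. -/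
def dualTwist (ρ : B ⊗[k] A →ₗ[k] A ⊗[k] B) (hρ : IsContinuousTwist ρ) :
    finiteDual k A ⊗[k] finiteDual k B →ₗ[k] finiteDual k B ⊗[k] finiteDual k A :=
  (dualTensorEquiv (cofinite k B) (cofinite k A) (cofinite_isCofinite k B)).symm.toLinearMap ∘ₗ
    dualMap ρ hρ ∘ₗ dualTensor (cofinite k A) (cofinite k B)

end Dual

end Crossed

/-! ### Module algebras and smash products -/

section Smash

variable (k : Type*) [Field k]

/-- The map `h ↦ h • a`. -/
def actOn (H : Type*) {A : Type*} [Ring H] [Algebra k H] [Ring A] [Algebra k A] [Module H A]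
    [IsScalarTower k H A] (a : A) : H →ₗ[k] A :=
  (LinearMap.toSpanSingleton H A a).restrictScalars k

@[simp]
theorem actOn_apply {H A : Type*} [Ring H] [Algebra k H] [Ring A] [Algebra k A] [Module H A]
    [IsScalarTower k H A] (a : A) (h : H) : actOn k H a h = h • a := rfl

/-- `A` is a left `H`-module algebra: `h • 1 = ε(h) 1` and
`h • (a b) = ∑ (h₁ • a) (h₂ • b)`. -/
class IsModuleAlgebra (H A : Type*) [Ring H] [Bialgebra k H] [Ring A] [Algebra k A]
    [Module H A] [IsScalarTower k H A] : Prop where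
  smul_one : ∀ h : H, h • (1 : A) = algebraMap k A (counit h)
  smul_mul : ∀ (h : H) (a b : A), h • (a * b) =
    LinearMap.mul' k A (TensorProduct.map (actOn k H a) (actOn k H b) (comul h))

theorem sum_counit_smul_smul (H A : Type*) [Ring H] [Bialgebra k H] [AddCommGroup A] [Module k A]
    (h : H) (c : A)
    (T : H ⊗[k] H →ₗ[k] A)
    (hT : ∀ u v : H, T (u ⊗ₜ v) = ((counit u : k) * (counit v : k)) • c) :
    T (comul h) = (counit h : k) • c := by
  have : T = (LinearMap.toSpanSingleton k A c) ∘ₗ (counit : H →ₗ[k] k) ∘ₗ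
      (TensorProduct.lid k H).toLinearMap ∘ₗ (counit : H →ₗ[k] k).rTensor H := by
    ext u v
    simp [hT]
  rw [this]
  simp

variable (H A : Type*) [Ring H] [Bialgebra k H] [Ring A] [Algebra k A] [Module H A]
  [IsScalarTower k H A]

/-- The subalgebra `A^H` of invariants: `a` with `h • a = ε(h) a` for all `h`. -/
def invariants [IsModuleAlgebra k H A] : Subalgebra k A where
  carrier := {a | ∀ h : H, h • a = (counit h : k) • a}
  algebraMap_mem' := fun r h => by
    rw [Algebra.algebraMap_eq_smul_one, smul_comm, IsModuleAlgebra.smul_one (k := k),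
      Algebra.algebraMap_eq_smul_one, smul_comm]
  add_mem' := fun {a b} ha hb h => by rw [smul_add, smul_add, ha h, hb h]
  mul_mem' := fun {a b} ha hb h => by
    rw [IsModuleAlgebra.smul_mul (k := k)]
    refine sum_counit_smul_smul k H A h (a * b)
      (LinearMap.mul' k A ∘ₗ TensorProduct.map (actOn k H a) (actOn k H b)) fun u v => ?_
    simp [ha u, hb v, smul_smul, mul_comm]

/-- The action `λ : H ⊗ A → A`. -/
def action : H ⊗[k] A →ₗ[k] A := TensorProduct.lift (LinearMap.flip
  { toFun := actOn k H
    map_add' := fun a b => by ext h; simp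
    map_smul' := fun r a => by ext h; exact smul_comm h r a } : H →ₗ[k] A →ₗ[k] A)

/-- The twisting map `ρ : H ⊗ A → A ⊗ H`, `ρ(h ⊗ a) = ∑ (h₁ • a) ⊗ h₂`. -/
def smashTwist : H ⊗[k] A →ₗ[k] A ⊗[k] H :=
  (action k H A).rTensor H ∘ₗ (TensorProduct.assoc k H A H).symm.toLinearMap ∘ₗ
    (TensorProduct.comm k H A).toLinearMap.lTensor H ∘ₗ
      (TensorProduct.assoc k H H A).toLinearMap ∘ₗ (comul : H →ₗ[k] H ⊗[k] H).rTensor A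

theorem smashTwist_tmul (h : H) (a : A) :
    smashTwist k H A (h ⊗ₜ a) = (actOn k H a).rTensor H (comul h) := by
  have : ∀ T : H ⊗[k] H, (action k H A).rTensor H ((TensorProduct.assoc k H A H).symm
      ((TensorProduct.comm k H A).toLinearMap.lTensor H (TensorProduct.assoc k H H A
        (T ⊗ₜ a)))) = (actOn k H a).rTensor H T := by
    intro T
    induction T with
    | zero => simp
    | add x y hx hy => simp only [TensorProduct.add_tmul, map_add, hx, hy]
    | tmul x y => simp [action]
  exact this _

theorem twistedMul_smashTwist (a b : A) (g h : H) :
    twistedMul (smashTwist k H A) ((a ⊗ₜ g) ⊗ₜ (b ⊗ₜ h)) =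
      TensorProduct.map (LinearMap.mulLeft k a ∘ₗ actOn k H b) (LinearMap.mulRight k h)
        (comul g) := by
  rw [twistedMul_tmul, smashTwist_tmul, ← LinearMap.comp_apply, LinearMap.map_comp_rTensor]

theorem smashTwist_assoc [IsModuleAlgebra k H A] (a b c : A) (g l s t : H) :
    (TensorProduct.map (LinearMap.mulLeft k a ∘ₗ actOn k H (b * s • c))
      (LinearMap.mulRight k (t * l))) (comul g) =
    ((LinearMap.mul' k A).rTensor H ∘ₗ (TensorProduct.assoc k A A H).symm.toLinearMap ∘ₗ
      TensorProduct.map (LinearMap.mulLeft k a ∘ₗ actOn k H b)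
        (TensorProduct.map (actOn k H (s • c)) (LinearMap.mulRight k (t * l))))
      (comul.lTensor H (comul g)) := by
  rw [← coassoc_apply]
  generalize (comul g : H ⊗[k] H) = T
  induction T with
  | zero => simp
  | add x y hx hy => simp only [map_add, hx, hy]
  | tmul u w =>
    have h1 : ∀ S : H ⊗[k] H, ((LinearMap.mul' k A).rTensor H ∘ₗ
        (TensorProduct.assoc k A A H).symm.toLinearMap ∘ₗ
        TensorProduct.map (LinearMap.mulLeft k a ∘ₗ actOn k H b)
          (TensorProduct.map (actOn k H (s • c)) (LinearMap.mulRight k (t * l))))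
        (TensorProduct.assoc k H H H (S ⊗ₜ w)) =
        (a * LinearMap.mul' k A (TensorProduct.map (actOn k H b) (actOn k H (s • c)) S)) ⊗ₜ
          (w * (t * l)) := by
      intro S
      induction S with
      | zero => simp
      | add x y hx hy => simp only [TensorProduct.add_tmul, map_add, hx, hy, mul_add]
      | tmul x y => simp [mul_assoc]
    rw [LinearMap.rTensor_tmul, h1, ← IsModuleAlgebra.smul_mul]
    simp [mul_assoc]

/-- The smash product map is a twisting map. -/
theorem isTwistingMap_smashTwist [IsModuleAlgebra k H A] :
    IsTwistingMap (smashTwist k H A) where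
  assoc := by
    intro x y z
    induction x with
    | zero => simp
    | add x x' hx hx' => simp only [TensorProduct.add_tmul, map_add, hx, hx']
    | tmul a g =>
    induction y with
    | zero => simp
    | add y y' hy hy' => simp only [TensorProduct.tmul_add, TensorProduct.add_tmul, map_add, hy, hy']
    | tmul b h =>
    induction z with
    | zero => simp
    | add z z' hz hz' => simp only [TensorProduct.tmul_add, map_add, hz, hz']
    | tmul c l =>
    rw [twistedMul_smashTwist, twistedMul_smashTwist]
    have hL : ∀ T : H ⊗[k] H, twistedMul (smashTwist k H A)
        (TensorProduct.map (LinearMap.mulLeft k a ∘ₗ actOn k H b) (LinearMap.mulRight k h) T ⊗ₜ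
          (c ⊗ₜ l)) =
        ((LinearMap.mul' k A).rTensor H ∘ₗ (TensorProduct.assoc k A A H).symm.toLinearMap ∘ₗ
          TensorProduct.map (LinearMap.mulLeft k a ∘ₗ actOn k H b)
            (TensorProduct.map (actOn k H c) (LinearMap.mulRight k l) ∘ₗ
              LinearMap.mulRight k (comul h))) (comul.lTensor H T) := by
      intro T
      induction T with
      | zero => simp
      | add x y hx hy => simp only [TensorProduct.add_tmul, map_add, hx, hy]
      | tmul u v =>
        rw [TensorProduct.map_tmul, twistedMul_smashTwist]
        simp only [LinearMap.mulRight_apply, Bialgebra.comul_mul, LinearMap.lTensor_tmul,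
          LinearMap.comp_apply, TensorProduct.map_tmul, LinearEquiv.coe_coe]
        generalize (comul v * comul h : H ⊗[k] H) = S
        induction S with
        | zero => simp
        | add x y hx hy => simp only [TensorProduct.tmul_add, map_add, hx, hy]
        | tmul x y => simp [mul_assoc]
    rw [hL]
    generalize (comul h : H ⊗[k] H) = S
    induction S with
    | zero =>
      have : LinearMap.mulRight k (0 : H ⊗[k] H) = 0 := by ext; simp
      simp [this]
    | add x y hx hy =>
      have : LinearMap.mulRight k (x + y) = LinearMap.mulRight k x + LinearMap.mulRight k y := by
        ext; simp [mul_add]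
      simp only [map_add, TensorProduct.tmul_add, this, LinearMap.comp_add, ← hx, ← hy,
        TensorProduct.map_add_right, LinearMap.add_apply, LinearMap.comp_apply] at hx hy ⊢
    | tmul s t =>
      rw [TensorProduct.map_tmul, twistedMul_smashTwist]
      have e : TensorProduct.map (actOn k H c) (LinearMap.mulRight k l) ∘ₗ
          LinearMap.mulRight k (s ⊗ₜ[k] t) =
          TensorProduct.map (actOn k H (s • c)) (LinearMap.mulRight k (t * l)) := by
        ext x y
        simp [mul_smul, mul_assoc]
      rw [e]
      exact (smashTwist_assoc k H A a b c g l s t).symm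
  one_mul := by
    intro x
    induction x with
    | zero => simp
    | add x x' hx hx' => simp only [TensorProduct.tmul_add, map_add, hx, hx']
    | tmul a g =>
      rw [twistedMul_smashTwist, Bialgebra.comul_one, Algebra.TensorProduct.one_def]
      simp
  mul_one := by
    intro x
    induction x with
    | zero => simp
    | add x x' hx hx' => simp only [TensorProduct.add_tmul, map_add, hx, hx']
    | tmul a g =>
      rw [twistedMul_smashTwist]
      have : TensorProduct.map (LinearMap.mulLeft k a ∘ₗ actOn k H (1 : A))
          (LinearMap.mulRight k (1 : H)) =
          TensorProduct.map (LinearMap.toSpanSingleton k A a) LinearMap.id ∘ₗ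
            (counit : H →ₗ[k] k).rTensor H := by
        ext u v
        simp [IsModuleAlgebra.smul_one (k := k), Algebra.algebraMap_eq_smul_one]
      rw [this, LinearMap.comp_apply, rTensor_counit_comul]
      simp

/-- The smash product algebra `A # H`. -/
abbrev SmashProduct [IsModuleAlgebra k H A] : Type _ :=
  TwistedTensor (smashTwist k H A) (isTwistingMap_smashTwist k H A)

end Smash

end HopfDual

end

/-! Everything rests on one topological fact: on the vector space `A ⊗ H`, the cofinite topology of
the algebra `A # H` is the topology of `A ⊗^! H`. It gives `(A # H)° = (A ⊗^! H)° ≅ A° ⊗ H°` as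
spaces. The rest is transposition: evaluations at elements of `A ⊗ H` separate the points of `A° ⊗
H°` (and, in pairs and triples, of its tensor powers), and under them `Δ_{ρ°}` is the transpose of
`m_ρ` (`dualDistrib_crossedComul_dualTwist`). So coassociativity and counitality of `Δ_{ρ°}` are
associativity and unitality of `m_ρ`, and the linear isomorphism respects the coalgebra structures.

One inclusion of topologies is elementary: since `a ⊗ h = (a ⊗ 1)(1 ⊗ h)`, an ideal of `A # H`
contains `I ⊗ H + A ⊗ J`, where `I` and `J` are its preimages in `A` and `H`. For the other, `I ⊗ H
+ A ⊗ J` must be an ideal for arbitrarily small open `I` and `J`. It is one as soon as `ρ(J ⊗ A + H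
⊗ I) ⊆ I ⊗ H + A ⊗ J`, a condition that also yields continuity of `ρ`.

Such pairs are cofinal because `K` is finite-dimensional. Shrink `I` to `{a | K a ⊆ I}`, the kernel
of `A → Hom(K, A/I)` (`exists_stable_ideal_le`). Shrink `J` to the kernel of the algebra map `(π ⊗
q) ∘ Δ : H → K ⊗ H/J`, with `q` the quotient map (`exists_coideal_le`). Both targets are
finite-dimensional. -/

namespace HopfDual

open LinearTopology

/-! ### Duality between twisting maps and cotwisting maps -/

section Pairing

variable {k A B : Type*} [Field k] [Ring A] [Algebra k A] [Ring B] [Algebra k B]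

/-- Evaluation at `x ∈ A ⊗ B`, as a functional on `A° ⊗ B°`. -/
noncomputable def evalTensor (x : A ⊗[k] B) : Module.Dual k (finiteDual k A ⊗[k] finiteDual k B) :=
  ((cofinite k A).tensor (cofinite k B)).eval x ∘ₗ dualTensor (cofinite k A) (cofinite k B)

theorem evalTensor_apply (x : A ⊗[k] B) (T : finiteDual k A ⊗[k] finiteDual k B) :
    evalTensor x T = (dualTensor (cofinite k A) (cofinite k B) T).1 x := rfl

theorem evalTensor_add (x y : A ⊗[k] B) : evalTensor (x + y) = evalTensor x + evalTensor y :=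
  LinearMap.ext fun T => map_add (dualTensor (cofinite k A) (cofinite k B) T).1 x y

theorem evalTensor_zero : evalTensor (0 : A ⊗[k] B) = 0 :=
  LinearMap.ext fun T => map_zero (dualTensor (cofinite k A) (cofinite k B) T).1

theorem evalTensor_tmul (a : A) (b : B) :
    evalTensor (a ⊗ₜ[k] b) = TensorProduct.dualDistrib k _ _
      ((cofinite k A).eval a ⊗ₜ (cofinite k B).eval b) :=
  LinearMap.ext fun T => dualTensor_apply_tmul _ _ T a b

theorem eq_of_evalTensor (T T' : finiteDual k A ⊗[k] finiteDual k B)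
    (h : ∀ x, evalTensor x T = evalTensor x T') : T = T' :=
  dualTensor_injective _ _ (Subtype.ext (LinearMap.ext h))

variable {ρ : B ⊗[k] A →ₗ[k] A ⊗[k] B}

/-- This adjunction is the only property of `ρ°` used below. -/
theorem evalTensor_dualTwist (hρ : IsContinuousTwist ρ) (T : finiteDual k A ⊗[k] finiteDual k B)
    (y : B ⊗[k] A) : evalTensor y (dualTwist ρ hρ T) = evalTensor (ρ y) T := by
  have : dualTensor (cofinite k B) (cofinite k A) (dualTwist ρ hρ T) =
      dualMap ρ hρ (dualTensor (cofinite k A) (cofinite k B) T) :=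
    (dualTensorEquiv _ _ (cofinite_isCofinite k B)).apply_symm_apply _
  rw [evalTensor_apply, this]
  rfl

theorem dualTensor_comul_comp_mk (φ : finiteDual k A) (a : A) :
    (dualTensor (cofinite k A) (cofinite k A) (comul φ)).1 ∘ₗ TensorProduct.mk k A A a =
      φ.1 ∘ₗ LinearMap.mulLeft k a :=
  LinearMap.ext fun c => (dualTensor_apply_tmul _ _ _ a c).trans
    (dualDistrib_finiteDualComul k A φ a c)

theorem dualTensor_comul_comp_mk_flip (φ : finiteDual k A) (a : A) :
    (dualTensor (cofinite k A) (cofinite k A) (comul φ)).1 ∘ₗ (TensorProduct.mk k A A).flip a =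
      φ.1 ∘ₗ LinearMap.mulRight k a :=
  LinearMap.ext fun c => (dualTensor_apply_tmul _ _ _ c a).trans
    (dualDistrib_finiteDualComul k A φ c a)

/-- The outer legs of `S` and `S'` are evaluated at `a` and `d`; the inner legs pass through `ρ°`,
which moves to `ρ` on `b ⊗ c`. Arbitrary `S` and `S'` stand in for `Δ(φ)` and `Δ(ψ)` so that
linearity reduces the claim to pure tensors. -/
theorem dualDistrib_evalTensor_middle (hρ : IsContinuousTwist ρ) (a c : A) (b d : B)
    (S : finiteDual k A ⊗[k] finiteDual k A) (S' : finiteDual k B ⊗[k] finiteDual k B) :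
    TensorProduct.dualDistrib k _ _ (evalTensor (a ⊗ₜ[k] b) ⊗ₜ evalTensor (c ⊗ₜ[k] d))
      (middle _ _ (dualTwist ρ hρ) (S ⊗ₜ S')) =
    TensorProduct.dualDistrib k _ _
      (((dualTensor (cofinite k A) (cofinite k A) S).1 ∘ₗ TensorProduct.mk k A A a) ⊗ₜ
        ((dualTensor (cofinite k B) (cofinite k B) S').1 ∘ₗ (TensorProduct.mk k B B).flip d))
      (ρ (b ⊗ₜ c)) := by
  induction S with
  | zero => simp
  | add x y hx hy =>
    simp only [TensorProduct.add_tmul, map_add, Submodule.coe_add, LinearMap.add_comp,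
      LinearMap.add_apply, hx, hy]
  | tmul φ₁ φ₂ =>
  induction S' with
  | zero => simp
  | add x y hx hy =>
    simp only [TensorProduct.tmul_add, map_add, Submodule.coe_add, LinearMap.add_comp,
      LinearMap.add_apply, hx, hy]
  | tmul ψ₁ ψ₂ =>
    have key : ∀ S : finiteDual k B ⊗[k] finiteDual k A,
        TensorProduct.dualDistrib k _ _ (evalTensor (a ⊗ₜ[k] b) ⊗ₜ evalTensor (c ⊗ₜ[k] d))
          ((TensorProduct.tensorTensorTensorAssoc k _ _ _ _).symm ((φ₁ ⊗ₜ S) ⊗ₜ ψ₂)) =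
        φ₁.1 a * evalTensor (b ⊗ₜ[k] c) S * ψ₂.1 d := by
      intro S
      induction S with
      | zero => simp
      | add x y hx hy =>
        simp only [TensorProduct.tmul_add, TensorProduct.add_tmul, map_add, hx, hy, mul_add,
          add_mul]
      | tmul x y =>
        simp [evalTensor_apply]
        ring
    have e₁ : (dualTensor (cofinite k A) (cofinite k A) (φ₁ ⊗ₜ φ₂)).1 ∘ₗ
        TensorProduct.mk k A A a = φ₁.1 a • φ₂.1 := LinearMap.ext fun _ => rfl
    have e₂ : (dualTensor (cofinite k B) (cofinite k B) (ψ₁ ⊗ₜ ψ₂)).1 ∘ₗ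
        (TensorProduct.mk k B B).flip d = ψ₂.1 d • ψ₁.1 :=
      LinearMap.ext fun _ => mul_comm _ _
    refine (key _).trans ?_
    rw [evalTensor_dualTwist, e₁, e₂, TensorProduct.smul_tmul_smul, map_smul]
    -- On a pure tensor of functionals, evaluation at a point is `dualDistrib` by definition.
    change _ = (φ₁.1 a * ψ₂.1 d) * evalTensor (ρ (b ⊗ₜ c)) (φ₂ ⊗ₜ ψ₁)
    rw [TensorProduct.mk_apply]
    ring

/-- The comultiplication `Δ_{ρ°}` is dual to the multiplication `m_ρ`. -/
theorem dualDistrib_crossedComul_dualTwist (hρ : IsContinuousTwist ρ) (x y : A ⊗[k] B)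
    (T : finiteDual k A ⊗[k] finiteDual k B) :
    TensorProduct.dualDistrib k _ _ (evalTensor x ⊗ₜ evalTensor y)
      (crossedComul (dualTwist ρ hρ) T) = evalTensor (twistedMul ρ (x ⊗ₜ y)) T := by
  induction x with
  | zero => simp [evalTensor_zero]
  | add x x' hx hx' =>
    simp only [evalTensor_add, TensorProduct.add_tmul, map_add, LinearMap.add_apply, hx, hx']
  | tmul a b =>
  induction y with
  | zero => simp [evalTensor_zero]
  | add x x' hx hx' =>
    simp only [evalTensor_add, TensorProduct.tmul_add, map_add, LinearMap.add_apply, hx, hx']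
  | tmul c d =>
  induction T with
  | zero => simp
  | add x x' hx hx' => simp only [map_add, hx, hx']
  | tmul φ ψ =>
    rw [twistedMul_tmul]
    refine (dualDistrib_evalTensor_middle hρ a c b d (comul φ) (comul ψ)).trans ?_
    rw [dualTensor_comul_comp_mk, dualTensor_comul_comp_mk_flip]
    -- Both sides are now linear in `ρ (b ⊗ c)`, and no property of `ρ` is needed: on `x ⊗ y` each
    -- is `φ(a x) ψ(y d)`.
    generalize ρ (b ⊗ₜ c) = R
    induction R with
    | zero => simp [evalTensor_zero]
    | add x y hx hy => simp only [map_add, evalTensor_add, LinearMap.add_apply, hx, hy]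
    | tmul x y => simp [evalTensor_apply]

theorem dualDistrib_comp_crossedComul (hρ : IsContinuousTwist ρ) (x y : A ⊗[k] B) :
    (TensorProduct.dualDistrib k _ _ (evalTensor x ⊗ₜ evalTensor y)).comp
      (crossedComul (dualTwist ρ hρ)) = evalTensor (twistedMul ρ (x ⊗ₜ y)) :=
  LinearMap.ext fun T => dualDistrib_crossedComul_dualTwist hρ x y T

theorem crossedCounit_finiteDual :
    crossedCounit k (finiteDual k A) (finiteDual k B) = evalTensor ((1 : A) ⊗ₜ[k] (1 : B)) :=
  (evalTensor_tmul 1 1).symm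

/-- Triples of evaluations separate the points of the threefold tensor product, and on the triple
`x, y, z` the two sides are evaluation at `(x y) z` and at `x (y z)`. -/
theorem coassoc_crossedComul_dualTwist (hρ : IsContinuousTwist ρ) (hm : IsTwistingMap ρ)
    (T : finiteDual k A ⊗[k] finiteDual k B) :
    TensorProduct.assoc k _ _ _ ((crossedComul (dualTwist ρ hρ)).rTensor _
      (crossedComul (dualTwist ρ hρ) T)) =
    (crossedComul (dualTwist ρ hρ)).lTensor _ (crossedComul (dualTwist ρ hρ) T) := by
  refine eq_of_dualDistrib evalTensor
    (fun p : (A ⊗[k] B) × (A ⊗[k] B) => TensorProduct.dualDistrib k _ _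
      (evalTensor p.1 ⊗ₜ evalTensor p.2))
    eq_of_evalTensor
    (fun T T' hT => eq_of_dualDistrib evalTensor evalTensor
      eq_of_evalTensor eq_of_evalTensor T T' fun x y => hT (x, y)) _ _ ?_
  rintro x ⟨y, z⟩
  rw [dualDistrib_assoc, dualDistrib_rTensor, dualDistrib_lTensor,
    dualDistrib_comp_crossedComul, dualDistrib_comp_crossedComul,
    dualDistrib_crossedComul_dualTwist, dualDistrib_crossedComul_dualTwist, hm.assoc]

/-- The counit is evaluation at `1 ⊗ 1`, so this is the transpose of the left unit law. The identity
of `k` alone separates points in the scalar factor. -/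
theorem rTensor_counit_crossedComul_dualTwist (hρ : IsContinuousTwist ρ) (hm : IsTwistingMap ρ)
    (T : finiteDual k A ⊗[k] finiteDual k B) :
    (crossedCounit k _ _).rTensor _ (crossedComul (dualTwist ρ hρ) T) = 1 ⊗ₜ T := by
  refine eq_of_dualDistrib (fun _ : Unit => (LinearMap.id : k →ₗ[k] k))
    evalTensor (fun _ _ h => h ()) eq_of_evalTensor _ _ fun i x => ?_
  rw [dualDistrib_rTensor, LinearMap.id_comp, crossedCounit_finiteDual,
    dualDistrib_crossedComul_dualTwist, hm.one_mul, TensorProduct.dualDistrib_apply,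
    LinearMap.id_apply, one_mul]

theorem lTensor_counit_crossedComul_dualTwist (hρ : IsContinuousTwist ρ) (hm : IsTwistingMap ρ)
    (T : finiteDual k A ⊗[k] finiteDual k B) :
    (crossedCounit k _ _).lTensor _ (crossedComul (dualTwist ρ hρ) T) = T ⊗ₜ 1 := by
  refine eq_of_dualDistrib evalTensor (fun _ : Unit => (LinearMap.id : k →ₗ[k] k))
    eq_of_evalTensor (fun _ _ h => h ()) _ _ fun x i => ?_
  rw [dualDistrib_lTensor, LinearMap.id_comp, crossedCounit_finiteDual,
    dualDistrib_crossedComul_dualTwist, hm.mul_one, TensorProduct.dualDistrib_apply,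
    LinearMap.id_apply, mul_one]

/-- The continuous dual of a continuous twisting map is a cotwisting map. -/
theorem isCotwistingMap_dualTwist (hρ : IsContinuousTwist ρ) (hm : IsTwistingMap ρ) :
    IsCotwistingMap (dualTwist ρ hρ) :=
  ⟨LinearMap.ext (coassoc_crossedComul_dualTwist hρ hm),
    LinearMap.ext (rTensor_counit_crossedComul_dualTwist hρ hm),
    LinearMap.ext (lTensor_counit_crossedComul_dualTwist hρ hm)⟩

/-! ### The coalgebra isomorphism, given equality of topologies -/

section Equiv

variable (hm : IsTwistingMap ρ)

theorem finiteDual_twistedTensor_eq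
    (h : ∀ W : Submodule k (A ⊗[k] B), W ∈ (cofinite k (TwistedTensor ρ hm)).opens ↔
      W ∈ ((cofinite k A).tensor (cofinite k B)).opens) :
    finiteDual k (TwistedTensor ρ hm) = ((cofinite k A).tensor (cofinite k B)).continuousDual := by
  ext φ
  rw [mem_continuousDual_iff]
  exact (h _).trans mem_continuousDual_iff.symm

/-- If the cofinite topology of `A #_ρ B` is that of `A ⊗^! B`, then
`A° ⊗ B° ≃ (A #_ρ B)°`. -/
noncomputable def tensorFiniteDualEquiv
    (h : ∀ W : Submodule k (A ⊗[k] B), W ∈ (cofinite k (TwistedTensor ρ hm)).opens ↔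
      W ∈ ((cofinite k A).tensor (cofinite k B)).opens) :
    (finiteDual k A ⊗[k] finiteDual k B) ≃ₗ[k] finiteDual k (TwistedTensor ρ hm) :=
  (dualTensorEquiv _ _ (cofinite_isCofinite k A)).trans
    (LinearEquiv.ofEq _ _ (finiteDual_twistedTensor_eq hm h).symm)

variable (h : ∀ W : Submodule k (A ⊗[k] B), W ∈ (cofinite k (TwistedTensor ρ hm)).opens ↔
  W ∈ ((cofinite k A).tensor (cofinite k B)).opens)

/-- The equivalence does not alter the functional on `A ⊗ B`; it only regards it as one on `A #_ρ
B`, which has the same underlying space. -/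
theorem eval_comp_tensorFiniteDualEquiv (x : TwistedTensor ρ hm) :
    (cofinite k (TwistedTensor ρ hm)).eval x ∘ₗ (tensorFiniteDualEquiv hm h).toLinearMap =
      evalTensor (show A ⊗[k] B from x) := rfl

/-- Tested against a pair `x, y`, both sides evaluate `T` at the product `m_ρ(x ⊗ y)`. -/
theorem comul_tensorFiniteDualEquiv (hρ : IsContinuousTwist ρ)
    (T : finiteDual k A ⊗[k] finiteDual k B) :
    TensorProduct.map (tensorFiniteDualEquiv hm h).toLinearMap
      (tensorFiniteDualEquiv hm h).toLinearMap (crossedComul (dualTwist ρ hρ) T) =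
    finiteDualComul k (TwistedTensor ρ hm) (tensorFiniteDualEquiv hm h T) := by
  refine eq_of_dualDistrib (cofinite k (TwistedTensor ρ hm)).eval
    (cofinite k (TwistedTensor ρ hm)).eval (eq_of_eval _) (eq_of_eval _) _ _ fun x y => ?_
  rw [dualDistrib_finiteDualComul, ← LinearMap.lTensor_comp_rTensor, LinearMap.comp_apply,
    dualDistrib_lTensor, dualDistrib_rTensor, eval_comp_tensorFiniteDualEquiv,
    eval_comp_tensorFiniteDualEquiv, dualDistrib_crossedComul_dualTwist]
  exact (LinearMap.congr_fun (eval_comp_tensorFiniteDualEquiv hm h (x * y)) T).symm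

/-- If the cofinite topology of `A #_ρ B` is that of `A ⊗^! B`, then
`(A #_ρ B)° ≃ A° #^{ρ°} B°`. -/
theorem nonempty_finiteDual_equiv_crossedCoalgebra
    (h : ∀ W : Submodule k (A ⊗[k] B), W ∈ (cofinite k (TwistedTensor ρ hm)).opens ↔
      W ∈ ((cofinite k A).tensor (cofinite k B)).opens)
    (hρ : IsContinuousTwist ρ)
    (hφ : IsCotwistingMap (dualTwist ρ hρ)) :
    Nonempty (finiteDual k (TwistedTensor ρ hm) ≃ₗc[k] CrossedCoalgebra (dualTwist ρ hρ) hφ) := by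
  let e : CrossedCoalgebra (dualTwist ρ hρ) hφ ≃ₗc[k] finiteDual k (TwistedTensor ρ hm) :=
    { tensorFiniteDualEquiv hm h with
      counit_comp := (eval_comp_tensorFiniteDualEquiv hm h 1).trans crossedCounit_finiteDual.symm
      map_comp_comul := LinearMap.ext fun T => comul_tensorFiniteDualEquiv hm h hρ T }
  exact ⟨e.symm⟩

end Equiv

end Pairing

/-! ### Shrinking open ideals of `A` and of `H` -/

section Stable

variable {k : Type*} [Field k]

/-- An open ideal of a module algebra over a finite-dimensional bialgebra contains a stable open
ideal. -/
theorem exists_stable_ideal_le {K A : Type*} [Ring K] [Bialgebra k K] [FiniteDimensional k K]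
    [Ring A] [Algebra k A] [Module K A] [IsScalarTower k K A] [IsModuleAlgebra k K A]
    (I : Ideal A) [I.IsTwoSided] (hI : (I.restrictScalars k).CoFG) :
    ∃ I' : Ideal A, I'.IsTwoSided ∧ (I'.restrictScalars k).CoFG ∧ I' ≤ I ∧
      ∀ (x : K), ∀ a ∈ I', x • a ∈ I' := by
  -- In `∑ (x₁ • a)(x₂ • b)` one factor of every term lies in `I`. The disjunction serves both the
  -- left and the right ideal property of `I'`.
  have hmul : ∀ (x : K) (a b : A), (∀ y : K, y • a ∈ I) ∨ (∀ y : K, y • b ∈ I) →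
      x • (a * b) ∈ I := by
    intro x a b h
    rw [IsModuleAlgebra.smul_mul (k := k)]
    generalize (comul x : K ⊗[k] K) = T
    induction T with
    | zero => simp
    | add S T hS hT => rw [map_add, map_add]; exact I.add_mem hS hT
    | tmul y z =>
      rcases h with h | h
      · exact I.mul_mem_right _ (h y)
      · exact I.mul_mem_left _ (h z)
  let I' : Ideal A :=
    { carrier := {a | ∀ x : K, x • a ∈ I}
      zero_mem' := fun x => by simp
      add_mem' := fun ha hb x => by rw [smul_add]; exact I.add_mem (ha x) (hb x)
      smul_mem' := fun b a ha x => hmul x b a (Or.inr ha) }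
  refine ⟨I', ⟨fun b ha x => hmul x _ b (Or.inl ha)⟩, ?_, fun a ha => by simpa using ha 1,
    fun x a ha y => by rw [smul_smul]; exact ha _⟩
  have : Module.Finite k (A ⧸ I.restrictScalars k) := hI
  -- `I'` is the kernel of `a ↦ (x ↦ x • a mod I)`, whose target `Hom(K, A/I)` is
  -- finite-dimensional.
  let f : A →ₗ[k] K →ₗ[k] A ⧸ I.restrictScalars k :=
    { toFun := fun a => (I.restrictScalars k).mkQ ∘ₗ actOn k K a
      map_add' := fun a b => by ext; simp
      map_smul' := fun r a => by
        ext x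
        simp [smul_comm x r a] }
  have hf : LinearMap.ker f = I'.restrictScalars k := by
    ext a
    rw [LinearMap.mem_ker, LinearMap.ext_iff]
    exact forall_congr' fun x => Submodule.Quotient.mk_eq_zero _
  rw [← hf]
  exact Submodule.CoFG.ker _

/-- Given a bialgebra map `π : H → K` with `K` finite-dimensional, every open ideal `J` of `H`
contains an open ideal `E` with `Δ(E) ⊆ ker π ⊗ H + H ⊗ E`. -/
theorem exists_coideal_le {H K : Type*} [Ring H] [Bialgebra k H] [Ring K] [Bialgebra k K]
    [FiniteDimensional k K] (π : H →ₐc[k] K) (J : Ideal H) [J.IsTwoSided]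
    (hJ : (J.restrictScalars k).CoFG) :
    ∃ E : Ideal H, E.IsTwoSided ∧ (E.restrictScalars k).CoFG ∧ E ≤ J ∧
      ∀ h ∈ E, (π : H →ₗ[k] K).rTensor H (comul h) ∈
        LinearMap.range ((E.restrictScalars k).subtype.lTensor K) := by
  have : Module.Finite k (H ⧸ J) := hJ
  let q : H →ₐ[k] H ⧸ J := Ideal.Quotient.mkₐ k J
  -- The required ideal is `E = ker F`: two-sided because `F` is an algebra map, of finite
  -- codimension because `K ⊗ H/J` is finite-dimensional.
  let F : H →ₐ[k] K ⊗[k] (H ⧸ J) :=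
    (Algebra.TensorProduct.map (π : H →ₐ[k] K) q).comp (Bialgebra.comulAlgHom k H)
  have hF : F.toLinearMap = TensorProduct.map (π : H →ₗ[k] K) q.toLinearMap ∘ₗ comul := rfl
  have hker : (RingHom.ker F).restrictScalars k = LinearMap.ker F.toLinearMap := rfl
  refine ⟨RingHom.ker F, inferInstance, ?_, ?_, ?_⟩
  · rw [hker]
    exact Submodule.CoFG.ker _
  · intro h hh
    -- Applying the counit of `K` to the first leg recovers `q` from `F`, so `ker F ⊆ ker q = J`.
    have h1 : (TensorProduct.lid k (H ⧸ J)) ((counit : K →ₗ[k] k).rTensor _ (F h)) = q h := by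
      change (TensorProduct.lid k (H ⧸ J)) ((counit : K →ₗ[k] k).rTensor _
        (TensorProduct.map (π : H →ₗ[k] K) q.toLinearMap (comul h))) = q h
      rw [← LinearMap.comp_apply (LinearMap.rTensor _ _), LinearMap.rTensor_comp_map]
      have h2 : (counit : K →ₗ[k] k) ∘ₗ (π : H →ₗ[k] K) = counit := by
        ext; simp
      rw [h2, ← LinearMap.lTensor_comp_rTensor, LinearMap.comp_apply, rTensor_counit_comul]
      simp
    rw [RingHom.mem_ker] at hh
    have h3 : F h = 0 := hh
    rw [h3, map_zero, map_zero] at h1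
    exact Ideal.Quotient.eq_zero_iff_mem.1 h1.symm
  · intro h hh
    rw [hker]
    -- By flatness `K ⊗ ker F` is the kernel of `id ⊗ F`, so it suffices that `(id ⊗ F)(π ⊗ id)Δ(h)
    -- = 0`.
    refine (Module.Flat.lTensor_exact K
      (f := (LinearMap.ker F.toLinearMap).subtype) (g := F.toLinearMap)
      (LinearMap.exact_subtype_ker_map _) _).1 ?_
    -- Since `π` preserves comultiplication, coassociativity turns `(π ⊗ F)Δ(h)` into `(Δ_K ⊗
    -- id)(F(h))`, up to rebracketing, and this vanishes for `h ∈ ker F`.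
    have h1 : ∀ T : H ⊗[k] H,
        TensorProduct.map (π : H →ₗ[k] K) (TensorProduct.map (π : H →ₗ[k] K) q.toLinearMap)
          (TensorProduct.assoc k H H H ((comul : H →ₗ[k] _).rTensor H T)) =
        TensorProduct.assoc k K K (H ⧸ J) ((comul : K →ₗ[k] _).rTensor (H ⧸ J)
          (TensorProduct.map (π : H →ₗ[k] K) q.toLinearMap T)) := by
      intro T
      induction T with
      | zero => simp
      | add S T hS hT => simp only [map_add, hS, hT]
      | tmul u w =>
        have h2 : comul ((π : H →ₗ[k] K) u) =
            TensorProduct.map (π : H →ₗ[k] K) (π : H →ₗ[k] K) (comul u) :=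
          (CoalgHomClass.map_comp_comul_apply π u).symm
        rw [TensorProduct.map_tmul, LinearMap.rTensor_tmul, LinearMap.rTensor_tmul, h2]
        generalize (comul u : H ⊗[k] H) = S
        induction S with
        | zero => simp
        | add S T hS hT => simp only [map_add, TensorProduct.add_tmul, hS, hT]
        | tmul x y => simp
    have h3 := h1 (comul h)
    rw [coassoc_apply] at h3
    have h4 : TensorProduct.map (π : H →ₗ[k] K) q.toLinearMap (comul h) = 0 := hh
    rw [h4, map_zero, map_zero, ← LinearMap.comp_apply, LinearMap.map_comp_lTensor] at h3
    rw [← LinearMap.comp_apply, LinearMap.lTensor_comp_rTensor, hF]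
    exact h3

end Stable

/-! ### Behaviour of `ρ` on the shrunken ideals -/

section Smash

variable {k H A K : Type*} [Field k] [Ring H] [HopfAlgebra k H]
    [Ring A] [Algebra k A] [Module H A] [IsScalarTower k H A]
    [Ring K] [HopfAlgebra k K]
    [Module K A] [IsScalarTower k K A]

/-- As the action factors through `π`, `ρ(h ⊗ a)` depends only on `(π ⊗ id)Δ(h)`: it is the image
under `(x ↦ x • a) ⊗ id`, which carries `K ⊗ E` into `A ⊗ E`. -/
theorem smashTwist_mem_of_mem_coideal (π : H →ₐc[k] K) (hπ : ∀ (h : H) (a : A), h • a = π h • a)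
    (E : Ideal H) (h : H) (hh : (π : H →ₗ[k] K).rTensor H (comul h) ∈
        LinearMap.range ((E.restrictScalars k).subtype.lTensor K)) (a : A) :
    smashTwist k H A (h ⊗ₜ a) ∈ LinearMap.range ((E.restrictScalars k).subtype.lTensor A) := by
  obtain ⟨T, hT⟩ := hh
  have e : actOn k H a = actOn k K a ∘ₗ (π : H →ₗ[k] K) := LinearMap.ext fun h => hπ h a
  refine ⟨(actOn k K a).rTensor _ T, ?_⟩
  rw [smashTwist_tmul, e, LinearMap.rTensor_comp, LinearMap.comp_apply, ← hT,
    ← LinearMap.comp_apply, ← LinearMap.comp_apply, LinearMap.lTensor_comp_rTensor,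
    LinearMap.rTensor_comp_lTensor]

theorem smashTwist_mem_of_mem_stable (I : Ideal A) (hI : ∀ (x : H), ∀ a ∈ I, x • a ∈ I) (h : H)
    (a : A) (ha : a ∈ I) :
    smashTwist k H A (h ⊗ₜ a) ∈ LinearMap.range ((I.restrictScalars k).subtype.rTensor H) := by
  rw [smashTwist_tmul]
  generalize (comul h : H ⊗[k] H) = T
  induction T with
  | zero => simp
  | add S T hS hT => rw [map_add]; exact Submodule.add_mem _ hS hT
  | tmul x y => exact ⟨⟨x • a, hI x a ha⟩ ⊗ₜ y, rfl⟩

end Smash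

/-! ### Subspaces `E₀ ⊗ F + E ⊗ F₀` -/

section TensorOpen

variable {k E F : Type*} [Field k] [AddCommGroup E] [Module k E] [AddCommGroup F] [Module k F]

theorem tensorOpen_mono {E₀ E₁ : Submodule k E} {F₀ F₁ : Submodule k F} (hE : E₀ ≤ E₁)
    (hF : F₀ ≤ F₁) : tensorOpen E₀ F₀ ≤ tensorOpen E₁ F₁ := by
  have h := tensorOpen_le_iff.1 (le_refl (tensorOpen E₁ F₁))
  exact tensorOpen_le_iff.2 ⟨fun x hx y => h.1 x (hE hx) y, fun x y hy => h.2 x y (hF hy)⟩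

/-- The subspace is the kernel of `E ⊗ F → E/E₀ ⊗ F/F₀`, whose target is finite-dimensional. -/
theorem tensorOpen_coFG {E₀ : Submodule k E} {F₀ : Submodule k F} (hE : E₀.CoFG) (hF : F₀.CoFG) :
    (tensorOpen E₀ F₀).CoFG := by
  have : Module.Finite k (E ⧸ E₀) := hE
  have : Module.Finite k (F ⧸ F₀) := hF
  refine (Submodule.CoFG.ker (TensorProduct.map E₀.mkQ F₀.mkQ)).of_le ?_
  rw [TensorProduct.map_ker (f := E₀.subtype) (g := E₀.mkQ) (f' := F₀.subtype) (g' := F₀.mkQ)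
    (LinearMap.exact_subtype_mkQ E₀) E₀.mkQ_surjective
    (LinearMap.exact_subtype_mkQ F₀) F₀.mkQ_surjective, sup_comm]
  exact le_rfl

end TensorOpen

/-! ### Compatible pairs of ideals give ideals of `A #_ρ B` -/

section Twist

variable {k A B : Type*} [Field k] [Ring A] [Algebra k A] [Ring B] [Algebra k B]
  {ρ : B ⊗[k] A →ₗ[k] A ⊗[k] B}

/-- A pair of ideals `I ⊆ A`, `J ⊆ B` is compatible with `ρ` when
`ρ(J ⊗ A + B ⊗ I) ⊆ I ⊗ B + A ⊗ J`. -/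
def IsCompatible (ρ : B ⊗[k] A →ₗ[k] A ⊗[k] B) (I : Ideal A) (J : Ideal B) : Prop :=
  tensorOpen (J.restrictScalars k) (I.restrictScalars k) ≤
    (tensorOpen (I.restrictScalars k) (J.restrictScalars k)).comap ρ

/-- Compatible pairs of open ideals form a base of the pairs of open ideals. -/
def HasCompatibleBase (ρ : B ⊗[k] A →ₗ[k] A ⊗[k] B) : Prop :=
  ∀ (I : Ideal A) (J : Ideal B), I.IsTwoSided → J.IsTwoSided → (I.restrictScalars k).CoFG →
    (J.restrictScalars k).CoFG → ∃ (I' : Ideal A) (J' : Ideal B), I'.IsTwoSided ∧ J'.IsTwoSided ∧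
      (I'.restrictScalars k).CoFG ∧ (J'.restrictScalars k).CoFG ∧ I' ≤ I ∧ J' ≤ J ∧
        IsCompatible ρ I' J'

theorem HasCompatibleBase.exists_of_mem_tensor (h : HasCompatibleBase ρ)
    {W : Submodule k (A ⊗[k] B)} (hW : W ∈ ((cofinite k A).tensor (cofinite k B)).opens) :
    ∃ (I : Ideal A) (J : Ideal B), I.IsTwoSided ∧ J.IsTwoSided ∧ (I.restrictScalars k).CoFG ∧
      (J.restrictScalars k).CoFG ∧ tensorOpen (I.restrictScalars k) (J.restrictScalars k) ≤ W ∧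
        IsCompatible ρ I J := by
  obtain ⟨E₀, ⟨I, hI, hI', hIE⟩, F₀, ⟨J, hJ, hJ', hJF⟩, hW⟩ := hW
  obtain ⟨I', J', hI₁, hJ₁, hI₂, hJ₂, hI₃, hJ₃, hIJ⟩ := h I J hI hJ hI' hJ'
  exact ⟨I', J', hI₁, hJ₁, hI₂, hJ₂, (tensorOpen_mono
    (fun x hx => hIE (hI₃ hx)) (fun x hx => hJF (hJ₃ hx))).trans hW, hIJ⟩

theorem HasCompatibleBase.isContinuousTwist (h : HasCompatibleBase ρ) : IsContinuousTwist ρ := by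
  refine isContinuous_iff.2 fun W hW => ?_
  obtain ⟨I, J, hI, hJ, hI', hJ', hW, hIJ⟩ := h.exists_of_mem_tensor hW
  exact ⟨_, ⟨J, hJ, hJ', le_rfl⟩, _, ⟨I, hI, hI', le_rfl⟩, hIJ.trans (Submodule.comap_mono hW)⟩

theorem map_mul_mem_tensorOpen (I : Ideal A) (J : Ideal B) [J.IsTwoSided] (a : A) (b : B)
    {S : A ⊗[k] B} (hS : S ∈ tensorOpen (I.restrictScalars k) (J.restrictScalars k)) :
    TensorProduct.map (LinearMap.mulLeft k a) (LinearMap.mulRight k b) S ∈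
      tensorOpen (I.restrictScalars k) (J.restrictScalars k) := by
  have h := tensorOpen_le_iff.1 (le_refl (tensorOpen (I.restrictScalars k) (J.restrictScalars k)))
  have : tensorOpen (I.restrictScalars k) (J.restrictScalars k) ≤
      (tensorOpen (I.restrictScalars k) (J.restrictScalars k)).comap
        (TensorProduct.map (LinearMap.mulLeft k a) (LinearMap.mulRight k b)) :=
    tensorOpen_le_iff.2 ⟨fun x hx y => h.1 _ (I.mul_mem_left a hx) _,
      fun x y hy => h.2 _ _ (J.mul_mem_right b hy)⟩
  exact this hS

theorem map_mul_mem_tensorOpen_left (I : Ideal A) [I.IsTwoSided] (J : Ideal B) {a : A}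
    (ha : a ∈ I) (b : B) (S : A ⊗[k] B) :
    TensorProduct.map (LinearMap.mulLeft k a) (LinearMap.mulRight k b) S ∈
      tensorOpen (I.restrictScalars k) (J.restrictScalars k) := by
  have h := tensorOpen_le_iff.1 (le_refl (tensorOpen (I.restrictScalars k) (J.restrictScalars k)))
  induction S with
  | zero => simp
  | add S T hS hT => rw [map_add]; exact Submodule.add_mem _ hS hT
  | tmul x y => exact h.1 _ (I.mul_mem_right x ha) _

theorem map_mul_mem_tensorOpen_right (I : Ideal A) (J : Ideal B) (a : A) {b : B} (hb : b ∈ J)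
    (S : A ⊗[k] B) :
    TensorProduct.map (LinearMap.mulLeft k a) (LinearMap.mulRight k b) S ∈
      tensorOpen (I.restrictScalars k) (J.restrictScalars k) := by
  have h := tensorOpen_le_iff.1 (le_refl (tensorOpen (I.restrictScalars k) (J.restrictScalars k)))
  induction S with
  | zero => simp
  | add S T hS hT => rw [map_add]; exact Submodule.add_mem _ hS hT
  | tmul x y => exact h.2 _ _ (J.mul_mem_left y hb)

/-- The product `(a ⊗ b)(c ⊗ d)` is `ρ(b ⊗ c)` multiplied by `a` on the left and `d` on the right.
For `c ∈ I` compatibility controls `ρ(b ⊗ c)`; for `d ∈ J` the outer factor `d` suffices, whatever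
`ρ` does. -/
theorem IsCompatible.twistedMul_mem_right (I : Ideal A) (J : Ideal B) [J.IsTwoSided]
    (h : IsCompatible ρ I J) (x : A ⊗[k] B)
    {y : A ⊗[k] B}
    (hy : y ∈ tensorOpen (I.restrictScalars k) (J.restrictScalars k)) :
    twistedMul ρ (x ⊗ₜ y) ∈ tensorOpen (I.restrictScalars k) (J.restrictScalars k) := by
  induction x with
  | zero => simp
  | add x x' hx hx' =>
    rw [TensorProduct.add_tmul, map_add]
    exact Submodule.add_mem _ hx hx'
  | tmul a b =>
    have h' := tensorOpen_le_iff.1 h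
    have : tensorOpen (I.restrictScalars k) (J.restrictScalars k) ≤
        (tensorOpen (I.restrictScalars k) (J.restrictScalars k)).comap
          (twistedMul ρ ∘ₗ TensorProduct.mk k _ _ (a ⊗ₜ b)) := by
      refine tensorOpen_le_iff.2 ⟨fun c hc d => ?_, fun c d hd => ?_⟩
      · rw [Submodule.mem_comap, LinearMap.comp_apply, TensorProduct.mk_apply, twistedMul_tmul]
        exact map_mul_mem_tensorOpen I J a d (h'.2 b c hc)
      · rw [Submodule.mem_comap, LinearMap.comp_apply, TensorProduct.mk_apply, twistedMul_tmul]
        exact map_mul_mem_tensorOpen_right I J a hd _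
    exact this hy

/-- Mirror image: `a ∈ I` acts as an outer factor, while `b ∈ J` needs compatibility. -/
theorem IsCompatible.twistedMul_mem_left (I : Ideal A) (J : Ideal B) [I.IsTwoSided]
    [J.IsTwoSided] (h : IsCompatible ρ I J) {x : A ⊗[k] B} (y : A ⊗[k] B)
    (hx : x ∈ tensorOpen (I.restrictScalars k) (J.restrictScalars k)) :
    twistedMul ρ (x ⊗ₜ y) ∈ tensorOpen (I.restrictScalars k) (J.restrictScalars k) := by
  induction y with
  | zero => simp
  | add x x' hx hx' =>
    rw [TensorProduct.tmul_add, map_add]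
    exact Submodule.add_mem _ hx hx'
  | tmul c d =>
    have h' := tensorOpen_le_iff.1 h
    have : tensorOpen (I.restrictScalars k) (J.restrictScalars k) ≤
        (tensorOpen (I.restrictScalars k) (J.restrictScalars k)).comap
          (twistedMul ρ ∘ₗ (TensorProduct.mk k _ _).flip (c ⊗ₜ d)) := by
      refine tensorOpen_le_iff.2 ⟨fun a ha b => ?_, fun a b hb => ?_⟩
      · rw [Submodule.mem_comap, LinearMap.comp_apply, LinearMap.flip_apply,
          TensorProduct.mk_apply, twistedMul_tmul]
        exact map_mul_mem_tensorOpen_left I J ha d _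
      · rw [Submodule.mem_comap, LinearMap.comp_apply, LinearMap.flip_apply,
          TensorProduct.mk_apply, twistedMul_tmul]
        exact map_mul_mem_tensorOpen I J a d (h'.1 b hb c)
    exact this hx

theorem HasCompatibleBase.mem_cofinite_of_mem_tensor (h : HasCompatibleBase ρ)
    (hm : IsTwistingMap ρ) {W : Submodule k (A ⊗[k] B)}
    (hW : W ∈ ((cofinite k A).tensor (cofinite k B)).opens) :
    W ∈ (cofinite k (TwistedTensor ρ hm)).opens := by
  obtain ⟨I, J, hI, hJ, hI', hJ', hW, hIJ⟩ := h.exists_of_mem_tensor hW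
  let L : Ideal (TwistedTensor ρ hm) :=
    { carrier := (tensorOpen (I.restrictScalars k) (J.restrictScalars k) : Set (A ⊗[k] B))
      zero_mem' := Submodule.zero_mem _
      add_mem' := Submodule.add_mem _
      smul_mem' := fun x y hy => hIJ.twistedMul_mem_right I J x hy }
  exact ⟨L, ⟨fun y hx => hIJ.twistedMul_mem_left I J y hx⟩, tensorOpen_coFG hI' hJ', hW⟩

end Twist

/-! ### The cofinite topology of `A # H` -/

section Smash

variable {k H A : Type*} [Field k] [Ring H] [HopfAlgebra k H]
  [Ring A] [Algebra k A] [Module H A] [IsScalarTower k H A]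

theorem hasCompatibleBase_smashTwist {K : Type*} [Ring K] [HopfAlgebra k K] [FiniteDimensional k K]
    [Module K A] [IsScalarTower k K A] [IsModuleAlgebra k K A]
    (π : H →ₐc[k] K) (hπ : ∀ (h : H) (a : A), h • a = π h • a) :
    HasCompatibleBase (smashTwist k H A) := by
  intro I J hI hJ hI' hJ'
  obtain ⟨I₁, hI₁, hI₂, hI₃, hI₄⟩ := exists_stable_ideal_le (K := K) I hI'
  obtain ⟨E, hE₁, hE₂, hE₃, hE₄⟩ := exists_coideal_le π J hJ'
  refine ⟨I₁, E, hI₁, hE₁, hI₂, hE₂, hI₃, hE₃, tensorOpen_le_iff.2 ⟨fun h hh a => ?_,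
    fun h a ha => ?_⟩⟩
  · exact Submodule.mem_sup_right (smashTwist_mem_of_mem_coideal π hπ E h (hE₄ h hh) a)
  · exact Submodule.mem_sup_left (smashTwist_mem_of_mem_stable I₁
      (fun x a ha => by rw [hπ]; exact hI₄ _ a ha) h a ha)

/-- Since `g₁ • 1 = ε(g₁) 1`, the counit axiom collapses `∑ a (g₁ • 1) ⊗ g₂ h`. -/
theorem twistedMul_smashTwist_one_tmul [IsModuleAlgebra k H A] (a : A) (g h : H) :
    twistedMul (smashTwist k H A) ((a ⊗ₜ g) ⊗ₜ (1 ⊗ₜ h)) = a ⊗ₜ (g * h) := by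
  rw [twistedMul_smashTwist]
  have : TensorProduct.map (LinearMap.mulLeft k a ∘ₗ actOn k H (1 : A)) (LinearMap.mulRight k h) =
      TensorProduct.map (LinearMap.toSpanSingleton k A a) (LinearMap.mulRight k h) ∘ₗ
        (counit : H →ₗ[k] k).rTensor H := by
    ext u v
    simp [IsModuleAlgebra.smul_one (k := k), Algebra.algebraMap_eq_smul_one]
  rw [this, LinearMap.comp_apply, rTensor_counit_comul]
  simp

theorem twistedMul_smashTwist_tmul_one (a b : A) (h : H) :
    twistedMul (smashTwist k H A) ((a ⊗ₜ 1) ⊗ₜ (b ⊗ₜ h)) = (a * b) ⊗ₜ h := by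
  rw [twistedMul_smashTwist, Bialgebra.comul_one, Algebra.TensorProduct.one_def]
  simp

/-- The embedding `A → A # H`. -/
noncomputable def smashInclLeft (k H A : Type*) [Field k] [Ring H] [HopfAlgebra k H]
    [Ring A] [Algebra k A] [Module H A] [IsScalarTower k H A] [IsModuleAlgebra k H A] :
    A →ₐ[k] SmashProduct k H A :=
  AlgHom.ofLinearMap ((TensorProduct.mk k A H).flip 1 : A →ₗ[k] A ⊗[k] H) rfl
    fun a b => (twistedMul_smashTwist_tmul_one a b 1).symm

/-- The embedding `H → A # H`. -/
noncomputable def smashInclRight (k H A : Type*) [Field k] [Ring H] [HopfAlgebra k H]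
    [Ring A] [Algebra k A] [Module H A] [IsScalarTower k H A] [IsModuleAlgebra k H A] :
    H →ₐ[k] SmashProduct k H A :=
  AlgHom.ofLinearMap (TensorProduct.mk k A H 1 : H →ₗ[k] A ⊗[k] H) rfl
    fun g h => (twistedMul_smashTwist_one_tmul 1 g h).symm

theorem smashInclLeft_mul_smashInclRight [IsModuleAlgebra k H A] (a : A) (h : H) :
    smashInclLeft k H A a * smashInclRight k H A h = (a ⊗ₜ[k] h : A ⊗[k] H) :=
  (twistedMul_smashTwist_tmul_one a 1 h).trans (by rw [mul_one])

/-- The preimage of an open ideal under an algebra homomorphism is an open ideal. -/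
theorem comap_ideal_mem_cofinite {R S : Type*} [Ring R] [Algebra k R] [Ring S] [Algebra k S]
    (f : R →ₐ[k] S) (L : Ideal S) [L.IsTwoSided] (hL : (L.restrictScalars k).CoFG) :
    (L.restrictScalars k).comap f.toLinearMap ∈ (cofinite k R).opens := by
  have : Module.Finite k (S ⧸ L.restrictScalars k) := hL
  have h : (L.restrictScalars k).comap f.toLinearMap =
      LinearMap.ker ((L.restrictScalars k).mkQ ∘ₗ f.toLinearMap) := by
    rw [LinearMap.ker_comp, Submodule.ker_mkQ]
  refine ⟨L.comap f, inferInstance, ?_, le_rfl⟩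
  change ((L.restrictScalars k).comap f.toLinearMap).CoFG
  rw [h]
  exact Submodule.CoFG.ker _

/-- The preimages of an open ideal `L` under `A → A # H` and `H → A # H` are open. If either factor
of `a ⊗ h = (a ⊗ 1)(1 ⊗ h)` lies in `L`, so does the product, because `L` is two-sided. -/
theorem mem_tensor_of_mem_cofinite_smashProduct [IsModuleAlgebra k H A]
    {W : Submodule k (A ⊗[k] H)}
    (hW : W ∈ (cofinite k (SmashProduct k H A)).opens) :
    W ∈ ((cofinite k A).tensor (cofinite k H)).opens := by
  obtain ⟨L, hL, hL', hLW⟩ := hW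
  refine ⟨_, comap_ideal_mem_cofinite (smashInclLeft k H A) L hL', _,
    comap_ideal_mem_cofinite (smashInclRight k H A) L hL', tensorOpen_le_iff.2
      ⟨fun a ha h => hLW ?_, fun a h hh => hLW ?_⟩⟩
  · rw [← smashInclLeft_mul_smashInclRight]
    exact hL.mul_mem_of_left _ ha
  · rw [← smashInclLeft_mul_smashInclRight]
    exact L.mul_mem_left _ hh

end Smash

end HopfDual

open HopfDual in
theorem mainTheorem10 {k H A K : Type*} [Field k] [Ring H] [HopfAlgebra k H]
    [Ring A] [Algebra k A] [Module H A] [IsScalarTower k H A] [IsModuleAlgebra k H A]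
    (hleft : Module.Finite (invariants k H A) A)
    (hright : Module.Finite (invariants k H A).op A)
    [Ring K] [HopfAlgebra k K] [FiniteDimensional k K]
    [Module K A] [IsScalarTower k K A] [IsModuleAlgebra k K A]
    (π : H →ₐc[k] K) (hπ : ∀ (h : H) (a : A), h • a = π h • a) :
    ∃ (hρ : IsContinuousTwist (smashTwist k H A))
      (hφ : IsCotwistingMap (dualTwist (smashTwist k H A) hρ)),
      Nonempty (finiteDual k (SmashProduct k H A) ≃ₗc[k]
        CrossedCoalgebra (dualTwist (smashTwist k H A) hρ) hφ) := by
  have hbase := hasCompatibleBase_smashTwist π hπ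
  have hm := isTwistingMap_smashTwist k H A
  refine ⟨hbase.isContinuousTwist, isCotwistingMap_dualTwist _ hm, ?_⟩
  -- The two implications are the two inclusions between the cofinite topology of `A # H` and that
  -- of `A ⊗^! H`; only the second draws on the compatible base.
  exact nonempty_finiteDual_equiv_crossedCoalgebra hm (fun W =>
    ⟨mem_tensor_of_mem_cofinite_smashProduct, hbase.mem_cofinite_of_mem_tensor hm⟩) _ _
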